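/- **Setting.** Let $f:\mathbb{R}^n\times\mathbb{R}^m\to\mathbb{R}^n$, $h,\Phi:\mathbb{R}^n\to\mathbb{R}$, $b:\mathbb{R}^m\to\mathbb{R}$, $w:\mathbb{R}^m\to\mathbb{R}^n$, $\beta>0$, $r\in\mathbb{Z}_{>0}$. Put $h_0(x,u)=h(x)$, $h_i(x,u)=\frac{\partial h_{i-1}}{\partial x}(x,u)f(x,u)+\beta h_{i-1}(x,u)$ for $i\ge 1$, and $\mathcal S_i=\{(x,u): b(u)\ge 0,\ h_i(x,u)\ge 0\}$. Assume: 1. for every constant input $u$, the system $\dot\xi=f(\xi,u)$ has the unique equilibrium $w(u)$, and it is globally exponentially stable; 2. $f$ is $C^{r+1}$ and $h$ is $C^{r+2}$; $\mathcal S_r\ne\emptyset$; $\frac{\partial h_r}{\partial u}(x,u)\ne 0$ for all $(x,u)\in\mathcal S_r$ with $h_r(x,u)=0$; $\frac{\partial h_i}{\partial u}(x,u)=0$ for all $(x,u)\in\mathcal S_r$ and $i<r$; $b$ is $C^2$ and $\nabla b(u)\neq 0$ for all $(x,u)\in\mathcal S_0$ with $b(u)=0$; $\Phi$ and $w$ are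 $C^2$. For $\epsilon,\alpha,\gamma>0$ let $g_{\epsilon,\alpha,\gamma}(x,u)$ be the solution $q\in\mathbb{R}^m$ of the quadratic program $$\min_q\ \tfrac12\big\|q+\epsilon\,\tfrac{\partial w}{\partial u}(u)^\top\nabla\Phi(x)\big\|^2\quad\text{s.t.}\quad \nabla b(u)^\top q+\alpha b(u)\ge 0,\quad \tfrac{\partial h_r}{\partial x}(x,u)f(x,u)+\tfrac{\partial h_r}{\partial u}(x,u)q+\gamma h_r(x,u)\ge 0,\tag{QP}$$ and consider the closed loop $\dot\xi=f(\xi,\upsilon)$, $\dot\upsilon=g_{\epsilon,\alpha,\gamma}(\xi,\upsilon)$ and the problem $$\min_{x,u}\ \Phi(x)\quad\text{s.t.}\quad x=w(u),\ h(x)\ge 0,\ b(u)\ge 0.\tag{P}$$ For a program $\min_y \phi(y,\theta)$ s.t. $a_i(y,\theta)\ge0$, $c_j(y,\theta)=0$ with parameter $\theta$, and $J(y,\theta)=\{i: a_i(y,\theta)=0\}$, MFCQ holds at $(y,\theta)$ if some $\psi$ satisfies $\frac{\partial a_i}{\partial y}(y,\theta)\psi>0$ for all $i\in J(y,\theta)$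 and $\frac{\partial c_j}{\partial y}(y,\theta)\psi=0$ for all $j$; CRCQ holds at $(y,\theta)$ if for every $\tilde J\subseteq J(y,\theta)$ the family $\{\frac{\partial a_i}{\partial y}\}_{i\in\tilde J}\cup\{\frac{\partial c_j}{\partial y}\}_j$ has constant rank in a neighborhood of $(y,\theta)$. Critical points are KKT points. In (QP) the decision variable is $q$ and the parameter is $(x,u)$; (P) has no parameter. **Theorem.** Let $(x_*,u_*)$ be a local optimum of (P) with $h(x_*)>0$, and let $\mathcal N$ be a neighborhood of $(x_*,u_*)$ that contains no other critical point of (P). Assume that all level sets $\{u:\Phi(w(u))=c\}$ are compact, and that at every feasible point of (P) in $\mathcal N$, MFCQ or CRCQ holds for (P). Then there exist $\epsilon_*,\gamma_*>0$ such that, for all $\epsilon\in(0,\epsilon_*)$, $\gamma\ge\gamma_*$ and $\alpha>0$ for which, at every $(x,u)\in\mathcal N$, (QP) is feasible, (QP) satisfies MFCQ or CRCQ at its solution, and the closed loop has a unique local solution starting from $(x,u)$, the point $(x_*,u_*)$ is locally asymptotically stable relative to $\mathcal S_r$ for the closed loop: for every neighborhood $\mathcal N_2$ of $(x_*,u_*)$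 there is a neighborhood $\mathcal N_1$ of $(x_*,u_*)$ such that from every point of $\mathcal N_1\cap\mathcal S_r$ a trajectory exists for all $t\ge 0$, and every such trajectory stays in $\mathcal N_2\cap\mathcal S_r$ for all $t\ge0$ and converges to $(x_*,u_*)$ as $t\to\infty$. -/

import Mathlib

open Set Filter Topology

noncomputable section

/-- The Euclidean space of dimension `n`. -/
abbrev Euc (n : ℕ) : Type := EuclideanSpace ℝ (Fin n)

/-- A parametric nonlinear program
`min_x obj x θ` subject to `ineq i x θ ≥ 0` for all `i` and `eqc j x θ = 0` for all `j`.
A program without parameter is one with `Θ = Unit`. -/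
structure ParamNLP (X Θ I J : Type) where
  obj : X → Θ → ℝ
  ineq : I → X → Θ → ℝ
  eqc : J → X → Θ → ℝ

namespace ParamNLP

section Points

variable {X Θ I J : Type} (P : ParamNLP X Θ I J)

/-- The feasible set for the parameter value `θ`. -/
def feasible (θ : Θ) : Set X :=
  {x | (∀ i, 0 ≤ P.ineq i x θ) ∧ ∀ j, P.eqc j x θ = 0}

/-- `x` is a (global) solution, i.e. `x` belongs to the argmin, for the parameter value `θ`. -/
def IsSolution (x : X) (θ : Θ) : Prop :=
  x ∈ P.feasible θ ∧ ∀ y ∈ P.feasible θ, P.obj x θ ≤ P.obj y θ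

/-- `x` is a local optimum for the parameter value `θ`. -/
def IsLocalOptimum [TopologicalSpace X] (x : X) (θ : Θ) : Prop :=
  x ∈ P.feasible θ ∧ ∀ᶠ y in 𝓝[P.feasible θ] x, P.obj x θ ≤ P.obj y θ

end Points

section Derivatives

variable {X Θ I J : Type} [NormedAddCommGroup X] [NormedSpace ℝ X] (P : ParamNLP X Θ I J)

/-- Differential, in the decision variable, of the `i`-th inequality constraint function. -/
def dineq (i : I) (x : X) (θ : Θ) : X →L[ℝ] ℝ := fderiv ℝ (fun y => P.ineq i y θ) x

/-- Differential, in the decision variable, of the `j`-th equality constraint function. -/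
def deqc (j : J) (x : X) (θ : Θ) : X →L[ℝ] ℝ := fderiv ℝ (fun y => P.eqc j y θ) x

/-- Critical (KKT) points: feasibility, stationarity, dual feasibility, complementarity. -/
def IsCritical [Fintype I] [Fintype J] (x : X) (θ : Θ) : Prop :=
  x ∈ P.feasible θ ∧ ∃ (lam : I → ℝ) (mu : J → ℝ),
    fderiv ℝ (fun y => P.obj y θ) x - ∑ i, lam i • P.dineq i x θ
      + ∑ j, mu j • P.deqc j x θ = 0 ∧
    (∀ i, 0 ≤ lam i) ∧ ∀ i, lam i * P.ineq i x θ = 0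

/-- Mangasarian-Fromovitz constraint qualification at `(x, θ)`. -/
def MFCQ (x : X) (θ : Θ) : Prop :=
  ∃ ψ : X, (∀ i, P.ineq i x θ = 0 → 0 < P.dineq i x θ ψ) ∧ ∀ j, P.deqc j x θ ψ = 0

/-- The rank of the family of constraint differentials that consists of the inequalities
with index in `K` and of all the equalities. -/
def constraintRank (K : Set I) (x : X) (θ : Θ) : ℕ :=
  Module.finrank ℝ (Submodule.span ℝ
    ((fun i => P.dineq i x θ) '' K ∪ Set.range (fun j => P.deqc j x θ)))

/-- Constant rank constraint qualification at `(x, θ)`. -/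
def CRCQ [TopologicalSpace Θ] (x : X) (θ : Θ) : Prop :=
  ∀ K ⊆ {i | P.ineq i x θ = 0},
    ∀ᶠ p in 𝓝 (x, θ), P.constraintRank K p.1 p.2 = P.constraintRank K x θ

end Derivatives

end ParamNLP

/-- `ξ` solves `ξ' = f (ξ, u)` on `[0, ∞)` for the constant input `u`. -/
def IsOpenLoopSolution {n m : ℕ} (f : Euc n × Euc m → Euc n) (u : Euc m) (ξ : ℝ → Euc n) : Prop :=
  ∀ t, 0 ≤ t → HasDerivWithinAt ξ (f (ξ t, u)) (Ici 0) t

/-- `xe` is a globally exponentially stable equilibrium of `ξ' = f (ξ, u)`. -/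
def IsGESEquilibrium {n m : ℕ} (f : Euc n × Euc m → Euc n) (u : Euc m) (xe : Euc n) : Prop :=
  f (xe, u) = 0 ∧
  (∀ x₀, ∃ ξ, IsOpenLoopSolution f u ξ ∧ ξ 0 = x₀) ∧
  ∃ M > 0, ∃ ρ > 0, ∀ ξ, IsOpenLoopSolution f u ξ →
    ∀ t, 0 ≤ t → ‖ξ t - xe‖ ≤ M * Real.exp (-ρ * t) * ‖ξ 0 - xe‖

/-- `w` is the steady-state map: for each constant input `u`, the point `w u` is the unique
equilibrium, and it is globally exponentially stable (with constants that may depend on `u`). -/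
def IsSteadyStateMap {n m : ℕ} (f : Euc n × Euc m → Euc n) (w : Euc m → Euc n) : Prop :=
  ∀ u, IsGESEquilibrium f u (w u) ∧ ∀ x, f (x, u) = 0 → x = w u

/-- The functions `h_0 = h` and `h_{i+1} = (∂h_i/∂x) f + β h_i`. -/
def hcbf {n m : ℕ} (f : Euc n × Euc m → Euc n) (h : Euc n → ℝ) (β : ℝ) :
    ℕ → Euc n × Euc m → ℝ
  | 0, z => h z.1
  | i + 1, z => fderiv ℝ (fun x => hcbf f h β i (x, z.2)) z.1 (f z) + β * hcbf f h β i z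

/-- The set `S_i` of the `(x, u)` with `b u ≥ 0` and `h_i (x, u) ≥ 0`. -/
def safeSet {n m : ℕ} (f : Euc n × Euc m → Euc n) (h : Euc n → ℝ) (b : Euc m → ℝ) (β : ℝ)
    (i : ℕ) : Set (Euc n × Euc m) :=
  {z | 0 ≤ b z.2 ∧ 0 ≤ hcbf f h β i z}

/-- The partial differential `∂h_i/∂u (x, u)`. -/
def dhcbfInput {n m : ℕ} (f : Euc n × Euc m → Euc n) (h : Euc n → ℝ) (β : ℝ) (i : ℕ)
    (z : Euc n × Euc m) : Euc m →L[ℝ] ℝ :=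
  fderiv ℝ (fun v => hcbf f h β i (z.1, v)) z.2

/-- The partial differential `∂h_i/∂x (x, u)`. -/
def dhcbfState {n m : ℕ} (f : Euc n × Euc m → Euc n) (h : Euc n → ℝ) (β : ℝ) (i : ℕ)
    (z : Euc n × Euc m) : Euc n →L[ℝ] ℝ :=
  fderiv ℝ (fun x => hcbf f h β i (x, z.2)) z.1

/-- The standing assumption on the relative degree `r` and on the regularity of the data. -/
structure RelativeDegreeRegularity {n m : ℕ} (f : Euc n × Euc m → Euc n) (w : Euc m → Euc n)
    (h : Euc n → ℝ) (b : Euc m → ℝ) (Φ : Euc n → ℝ) (β : ℝ) (r : ℕ) : Prop where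
  r_pos : 0 < r
  f_smooth : ContDiff ℝ ((r + 1 : ℕ) : WithTop ℕ∞) f
  h_smooth : ContDiff ℝ ((r + 2 : ℕ) : WithTop ℕ∞) h
  safeSet_nonempty : (safeSet f h b β r).Nonempty
  input_appears : ∀ z ∈ safeSet f h b β r, hcbf f h β r z = 0 → dhcbfInput f h β r z ≠ 0
  input_absent : ∀ z ∈ safeSet f h b β r, ∀ i < r, dhcbfInput f h β i z = 0
  b_smooth : ContDiff ℝ 2 b
  b_regular : ∀ z ∈ safeSet f h b β 0, b z.2 = 0 → gradient b z.2 ≠ 0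
  Φ_smooth : ContDiff ℝ 2 Φ
  w_smooth : ContDiff ℝ 2 w

/-- The feedback-optimization problem: minimize `Φ x` over `(x, u)` subject to
`x = w u` (coordinatewise), `h x ≥ 0` and `b u ≥ 0`. -/
def feedbackProblem {n m : ℕ} (w : Euc m → Euc n) (h : Euc n → ℝ) (b : Euc m → ℝ)
    (Φ : Euc n → ℝ) : ParamNLP (Euc n × Euc m) Unit (Fin 2) (Fin n) where
  obj z _ := Φ z.1
  ineq i z _ := ![h z.1, b z.2] i
  eqc j z _ := z.1 j - w z.2 j

/-- The quadratic program, in the decision variable `q` and with the parameter `z = (x, u)`, whose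
solution is the safe gradient flow controller. -/
def sgfQP {n m : ℕ} (f : Euc n × Euc m → Euc n) (w : Euc m → Euc n) (h : Euc n → ℝ)
    (b : Euc m → ℝ) (Φ : Euc n → ℝ) (β : ℝ) (r : ℕ) (ε α γ : ℝ) :
    ParamNLP (Euc m) (Euc n × Euc m) (Fin 2) (Fin 0) where
  obj q z := 1 / 2 *
    ‖q + ε • (ContinuousLinearMap.adjoint (fderiv ℝ w z.2)) (gradient Φ z.1)‖ ^ 2
  ineq i q z :=
    ![inner ℝ (gradient b z.2) q + α * b z.2,
      dhcbfState f h β r z (f z) + dhcbfInput f h β r z q + γ * hcbf f h β r z] i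
  eqc j _ _ := j.elim0

/-- `z = (ξ, υ)` solves on the time interval `T` the closed loop `ξ' = f (ξ, υ)`,
`υ' = ` the solution of the quadratic program `Q` at `(ξ, υ)`. -/
def IsClosedLoopSolutionOn {n m : ℕ} (f : Euc n × Euc m → Euc n)
    (Q : ParamNLP (Euc m) (Euc n × Euc m) (Fin 2) (Fin 0)) (T : Set ℝ)
    (z : ℝ → Euc n × Euc m) : Prop :=
  ∀ t ∈ T, ∃ q, Q.IsSolution q (z t) ∧ HasDerivWithinAt z (f (z t), q) T t

/-- From `z₀` there is a solution of the closed loop on some interval `[0, τ)`, `τ > 0`, and it is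
the only one on that interval. -/
def HasUniqueClosedLoopSolution {n m : ℕ} (f : Euc n × Euc m → Euc n)
    (Q : ParamNLP (Euc m) (Euc n × Euc m) (Fin 2) (Fin 0)) (z₀ : Euc n × Euc m) : Prop :=
  ∃ τ > 0, (∃ z, IsClosedLoopSolutionOn f Q (Ico 0 τ) z ∧ z 0 = z₀) ∧
    ∀ y z, IsClosedLoopSolutionOn f Q (Ico 0 τ) y → y 0 = z₀ →
      IsClosedLoopSolutionOn f Q (Ico 0 τ) z → z 0 = z₀ → EqOn y z (Ico 0 τ)

/-- Local asymptotic stability of `zs` relative to `S`, for the trajectories `z : [0, ∞) → Z`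
described by `IsTraj`: for each neighborhood `N₂` of `zs` there is a neighborhood `N₁` of `zs` such
that from each point of `N₁ ∩ S` a trajectory exists for all times `t ≥ 0`, and each such
trajectory stays in `N₂ ∩ S` and converges to `zs`. -/
def IsLocallyAsymptoticallyStableRel {Z : Type} [TopologicalSpace Z] (IsTraj : (ℝ → Z) → Prop)
    (S : Set Z) (zs : Z) : Prop :=
  ∀ N₂ ∈ 𝓝 zs, ∃ N₁ ∈ 𝓝 zs, ∀ z₀ ∈ N₁ ∩ S,
    (∃ z, IsTraj z ∧ z 0 = z₀) ∧
    ∀ z, IsTraj z → z 0 = z₀ → (∀ t, 0 ≤ t → z t ∈ N₂ ∩ S) ∧ Tendsto z atTop (𝓝 zs)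

end

/-!
The steady state `(xs, us)` satisfies `f (xs, us) = 0`, so `h_r (xs, us) = β ^ r h (xs) > 0`: near
the optimum the only constraint that can be active is `b u ≥ 0`, and `∇b ≠ 0` where it is active.
This has two consequences.

* The reduced problem `min Φ (w u)` subject to `b u ≥ 0` has a strict local minimum at `us`:
  a nearby point with the same value would be a local optimum as well, hence by the
  Karush-Kuhn-Tucker conditions a second critical point (`eventually_lt_of_isLocalOptimum`).
* The quadratic program is solved, near `(xs, us)`, by the projection `k` of
  `-ε ∂w/∂uᵀ ∇Φ` onto the half-space `∇bᵀ q + α b ≥ 0` (`sgfQP_isSolution_iff`). Indeed `k` is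
  locally Lipschitz and vanishes at `(xs, us)`, so the constraint on `h_r` has slack at `k` there.

The stability proof is a singular perturbation argument. Exponential stability for the constant
input `us` passes to the linearization of `f` in `x`, whose quadratic Lyapunov function
`⟪P y, y⟫` also works for the nearby inputs. With `y = x - w u`, the composite function
`Φ (w u) - Φ (w us) + ⟪P y, y⟫` has, along the closed loop in `b ≥ 0`, a derivative of at most
`-‖k‖² / ε + C ‖y‖ ‖k‖ - ‖y‖² / 2`, where the first term comes from the variational inequality of
the projection tested at `q = 0`, and `C` does not depend on `ε`, `α`, `γ`
(`exists_compositeLyapunov_bound`). For `ε < 1 / (C² + 1)` this is at most `-‖k‖² - ‖y‖² / 4`,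
which vanishes only at points `(w u, u)` with `k = 0`, that is at critical points, hence only at
`(xs, us)`. Since `b` decays at most at the rate `α`, the set `b ≥ 0` is invariant, and
Lyapunov's theorem relative to that set (`lyapunov_stable_rel`) gives stability and convergence of
every trajectory. Trajectories for all times come from a bounded Lipschitz extension of the
closed-loop vector field, whose solutions never leave the region where nothing was changed.

The neighborhoods depend on `ε`, `α` and `γ`, so any `γ > 0` would do; the threshold `1` is used.
-/

/-! ### Global solutions of autonomous ordinary differential equations -/

open scoped NNReal in
/-- A bounded Lipschitz vector field has forward solutions for all times. -/
theorem exists_forward_solution_of_lipschitz_of_bounded {E : Type*} [NormedAddCommGroup E]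
    [NormedSpace ℝ E] [CompleteSpace E] {v : E → E} {K L : ℝ≥0} (hv : LipschitzWith K v)
    (hL : ∀ x, ‖v x‖ ≤ L) (x₀ : E) :
    ∃ γ : ℝ → E, γ 0 = x₀ ∧ ∀ t, 0 ≤ t → HasDerivWithinAt γ (v (γ t)) (Ici 0) t := by
  -- The Picard-Lindelöf theorem applies on every interval `[0, k]`.
  have hex : ∀ k : ℕ, ∃ α : ℝ → E, α 0 = x₀ ∧
      ∀ t ∈ Icc (0 : ℝ) k, HasDerivWithinAt α (v (α t)) (Icc 0 k) t := by
    intro k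
    have hpl : IsPicardLindelof (fun _ => v) (tmin := 0) (tmax := (k : ℝ))
        ⟨0, le_rfl, Nat.cast_nonneg k⟩ x₀ (L * k) 0 L K :=
      { lipschitzOnWith := fun _ _ => hv.lipschitzOnWith
        continuousOn := fun _ _ => continuousOn_const
        norm_le := fun _ _ x _ => hL x
        mul_max_le := by simp }
    exact hpl.exists_eq_forall_mem_Icc_hasDerivWithinAt₀
  choose α hα0 hα using hex
  have hIci : ∀ k : ℕ, ∀ t ∈ Ico (0 : ℝ) k, HasDerivWithinAt (α k) (v (α k t)) (Ici t) t := by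
    intro k t ht
    refine ((hα k t ⟨ht.1, ht.2.le⟩).mono (Icc_subset_Icc_left ht.1)).mono_of_mem_nhdsWithin ?_
    exact Icc_mem_nhdsGE ht.2
  have heq : ∀ k l : ℕ, k ≤ l → EqOn (α k) (α l) (Icc 0 k) := by
    intro k l hkl
    have hkl' : (k : ℝ) ≤ l := by exact_mod_cast hkl
    refine ODE_solution_unique_of_mem_Icc_right (v := fun _ => v) (s := fun _ => univ) (K := K)
      (fun t _ => hv.lipschitzOnWith) (fun t ht => (hα k t ht).continuousWithinAt)
      (fun t ht => hIci k t ht) (fun _ _ => mem_univ _) ?_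
      (fun t ht => hIci l t ⟨ht.1, ht.2.trans_le hkl'⟩) (fun _ _ => mem_univ _)
      ((hα0 k).trans (hα0 l).symm)
    exact fun t ht => ((hα l t ⟨ht.1, ht.2.trans hkl'⟩).continuousWithinAt).mono
      (Icc_subset_Icc_right hkl')
  let γ : ℝ → E := fun t => α ⌈t⌉₊ t
  have hγ : ∀ k : ℕ, EqOn γ (α k) (Icc 0 k) := by
    intro k t ht
    exact heq _ _ (Nat.ceil_le.2 ht.2) ⟨ht.1, Nat.le_ceil t⟩
  refine ⟨γ, by simp [γ, hα0], fun t ht => ?_⟩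
  obtain ⟨k, hk⟩ := exists_nat_gt t
  have hmem : Icc (0 : ℝ) k ∈ 𝓝[Ici 0] t := by
    rw [← Ici_inter_Iic]
    exact inter_mem self_mem_nhdsWithin (mem_nhdsWithin_of_mem_nhds (Iic_mem_nhds hk))
  have h1 := (hα k t ⟨ht, hk.le⟩).congr (hγ k) (hγ k ⟨ht, hk.le⟩)
  rw [← hγ k ⟨ht, hk.le⟩] at h1
  exact h1.mono_of_mem_nhdsWithin hmem

open scoped NNReal in
/-- In finite dimension, a bounded Lipschitz map on a set extends to a bounded Lipschitz map: a
Lipschitz extension is truncated coordinate by coordinate. -/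
theorem LipschitzOnWith.exists_bounded_extension {X E : Type*} [PseudoMetricSpace X]
    [NormedAddCommGroup E] [NormedSpace ℝ E] [FiniteDimensional ℝ E] {v : X → E} {s : Set X}
    {K : ℝ≥0} (hv : LipschitzOnWith K v s) {M : ℝ} (hM : ∀ x ∈ s, ‖v x‖ ≤ M) :
    ∃ (v' : X → E) (K' L' : ℝ≥0), LipschitzWith K' v' ∧ (∀ x, ‖v' x‖ ≤ L') ∧ EqOn v v' s := by
  let e := (Module.finBasis ℝ E).equivFunL
  let efun : E →L[ℝ] Fin (Module.finrank ℝ E) → ℝ := e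
  let einv : (Fin (Module.finrank ℝ E) → ℝ) →L[ℝ] E := e.symm
  obtain ⟨g, hg, hgv⟩ := (e.lipschitz.comp_lipschitzOnWith hv).extend_pi
  have hc0 : (-(‖efun‖ * |M|)) ≤ ‖efun‖ * |M| := by
    linarith [mul_nonneg (norm_nonneg efun) (abs_nonneg M)]
  set c : ℝ := ‖efun‖ * |M| with hc
  let τ : (Fin (Module.finrank ℝ E) → ℝ) → (Fin (Module.finrank ℝ E) → ℝ) :=
    fun y i => max (-c) (min c (y i))
  have hτ : LipschitzWith 1 τ := by
    refine LipschitzWith.of_dist_le_mul fun y z => ?_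
    rw [NNReal.coe_one, one_mul]
    refine (dist_pi_le_iff dist_nonneg).2 fun i => ?_
    have := ((LipschitzWith.eval (α := fun _ => ℝ) i).const_min c).const_max (-c)
    simpa using this.dist_le_mul y z
  have hτb : ∀ y, ‖τ y‖ ≤ c := by
    intro y
    refine (pi_norm_le_iff_of_nonneg (by linarith)).2 fun i => abs_le.2 ⟨le_max_left _ _, ?_⟩
    exact max_le hc0 (min_le_left _ _)
  refine ⟨fun x => e.symm (τ (g x)), _, ‖einv‖₊ * ⟨c, by linarith⟩,
    e.symm.lipschitz.comp (hτ.comp hg), fun x => ?_, fun x hx => ?_⟩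
  · refine (einv.le_opNorm _).trans ?_
    exact mul_le_mul_of_nonneg_left (hτb (g x)) (norm_nonneg einv)
  · have hb : ‖e (v x)‖ ≤ c := (efun.le_opNorm _).trans
      (mul_le_mul_of_nonneg_left ((hM x hx).trans (le_abs_self M)) (norm_nonneg _))
    have : τ (g x) = e (v x) := by
      rw [← hgv hx]
      funext i
      have := abs_le.1 ((norm_le_pi_norm (e (v x)) i).trans hb)
      simp only [τ, Function.comp]
      rw [min_eq_right this.2, max_eq_right this.1]
    simp [this]

/-! ### A Lyapunov theorem relative to a set -/

/-- A continuous function that starts below the level `r` and reaches it has a first time where it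
equals `r`. -/
theorem exists_first_hitting_time {g : ℝ → ℝ} {t r : ℝ} (ht : 0 ≤ t)
    (hg : ContinuousOn g (Icc 0 t)) (h0 : g 0 < r) (htr : r ≤ g t) :
    ∃ T ∈ Icc 0 t, g T = r ∧ ∀ s ∈ Icc 0 T, g s ≤ r := by
  have hcomp : IsCompact {s ∈ Icc 0 t | r ≤ g s} := by
    have := hg.preimage_isClosed_of_isClosed isClosed_Icc (isClosed_Ici (a := r))
    exact isCompact_Icc.of_isClosed_subset this inter_subset_left
  obtain ⟨T, ⟨hT, hrT⟩, hleast⟩ := hcomp.exists_isLeast ⟨t, ⟨ht, le_rfl⟩, htr⟩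
  have hlt : ∀ s ∈ Ico 0 T, g s < r := by
    intro s hs
    by_contra! hcon
    exact absurd (hleast ⟨⟨hs.1, hs.2.le.trans hT.2⟩, hcon⟩) (not_le.2 hs.2)
  obtain ⟨c, hc, hgc⟩ := intermediate_value_Icc hT.1 (hg.mono (Icc_subset_Icc_right hT.2))
    ⟨h0.le, hrT⟩
  have hcT : c = T := by
    by_contra hne
    exact absurd hgc (hlt c ⟨hc.1, lt_of_le_of_ne hc.2 hne⟩).ne
  subst hcT
  refine ⟨c, hT, hgc, fun s hs => ?_⟩
  rcases hs.2.lt_or_eq with h | h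
  · exact (hlt s ⟨hs.1, h⟩).le
  · rw [h, hgc]

/-- A function with right-sided derivatives at most `-d` decreases at least at the rate `d`. -/
theorem le_sub_mul_of_hasDerivWithinAt_le {g : ℝ → ℝ} {T d : ℝ} (hT : 0 ≤ T)
    (hg : ∀ t ∈ Icc 0 T, ∃ g', HasDerivWithinAt g g' (Ici 0) t ∧ g' ≤ -d) :
    g T ≤ g 0 - d * T := by
  choose! g' hg' hle using hg
  have := image_le_of_deriv_right_le_deriv_boundary (f := g) (f' := g') (a := 0) (b := T)
    (B := fun t => g 0 - d * t) (B' := fun _ => -d)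
    (fun t ht => (hg' t ht).continuousWithinAt.mono (fun s hs => hs.1))
    (fun t ht => (hg' t ⟨ht.1, ht.2.le⟩).mono (Ici_subset_Ici.2 ht.1)) (by simp)
    (by fun_prop)
    (fun t _ => by
      simpa using ((hasDerivWithinAt_id t (Ici t)).const_mul d).const_sub (g 0))
    (fun t ht => hle t ⟨ht.1, ht.2.le⟩)
  exact this ⟨hT, le_rfl⟩

/-- Lyapunov's theorem for the curves in a closed set `S`. The function `U` is positive on `S` off
`a` near `a`, and along the curves considered it decreases at least at the rate `D > 0`. What is
asked of a curve is asked only on time intervals on which it has not left the closed ball of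
radius `R`. -/
theorem lyapunov_stable_rel {E : Type*} [NormedAddCommGroup E] [ProperSpace E]
    {a : E} {R : ℝ} (hR : 0 < R) {S : Set E} (hS : IsClosed S) {U D : E → ℝ}
    (hUc : ContinuousOn U (Metric.closedBall a R)) (hDc : ContinuousOn D (Metric.closedBall a R))
    (hUa : U a = 0)
    (hpos : ∀ z ∈ Metric.closedBall a R ∩ S, z ≠ a → 0 < U z ∧ 0 < D z)
    (hDa : 0 ≤ D a) {r : ℝ} (hr : 0 < r) :
    ∃ δ > 0, ∀ γ : ℝ → E, ContinuousOn γ (Ici 0) → γ 0 ∈ Metric.ball a δ →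
      (∀ T, 0 ≤ T → (∀ t ∈ Icc 0 T, γ t ∈ Metric.closedBall a R) → ∀ t ∈ Icc 0 T, γ t ∈ S ∧
        ∃ u', HasDerivWithinAt (fun t => U (γ t)) u' (Ici 0) t ∧ u' ≤ -D (γ t)) →
      (∀ t, 0 ≤ t → γ t ∈ Metric.ball a r ∩ S) ∧ Tendsto γ atTop (𝓝 a) := by
  -- A positive lower bound of a continuous function on an annulus.
  have key : ∀ ρ, 0 < ρ → ∀ W : E → ℝ, ContinuousOn W (Metric.closedBall a R) →
      (∀ z ∈ Metric.closedBall a R ∩ S, z ≠ a → 0 < W z) →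
      ∃ μ > 0, ∀ z ∈ Metric.closedBall a R ∩ S, ρ ≤ dist z a → μ ≤ W z := by
    intro ρ hρ W hW hWpos
    have hcomp : IsCompact ((Metric.closedBall a R ∩ S) ∩ {z | ρ ≤ dist z a}) :=
      ((isCompact_closedBall a R).inter_right hS).inter_right
        (isClosed_le continuous_const (by fun_prop))
    rcases ((Metric.closedBall a R ∩ S) ∩ {z | ρ ≤ dist z a}).eq_empty_or_nonempty with h | h
    · refine ⟨1, one_pos, fun z hz hz' => ?_⟩
      exact absurd (show z ∈ (∅ : Set E) from h ▸ ⟨hz, hz'⟩) (notMem_empty z)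
    · obtain ⟨z, hz, hmin⟩ := hcomp.exists_isMinOn h (hW.mono fun z hz => hz.1.1)
      refine ⟨W z, hWpos z hz.1 ?_, fun y hy hy' => hmin ⟨hy, hy'⟩⟩
      rintro rfl
      have : ρ ≤ dist z z := hz.2
      rw [dist_self] at this
      linarith
  have hUnhds : ∀ μ > 0, ∃ δ > 0, ∀ z ∈ Metric.ball a δ, U z < μ := by
    intro μ hμ
    have hUat : ContinuousAt U a := hUc.continuousAt (Metric.closedBall_mem_nhds a hR)
    have := hUat.eventually_lt (continuousAt_const (y := μ)) (by rwa [hUa])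
    exact Metric.eventually_nhds_iff_ball.1 this
  have hD0 : ∀ z ∈ Metric.closedBall a R ∩ S, 0 ≤ D z := by
    intro z hz
    by_cases h : z = a
    · rwa [h]
    · exact (hpos z hz h).2.le
  have hU0 : ∀ z ∈ Metric.closedBall a R ∩ S, 0 ≤ U z := by
    intro z hz
    by_cases h : z = a
    · rw [h, hUa]
    · exact (hpos z hz h).1.le
  set ρ := min r R with hρ
  have hρ0 : 0 < ρ := lt_min hr hR
  obtain ⟨μ, hμ, hμU⟩ := key ρ hρ0 U hUc fun z hz h => (hpos z hz h).1
  obtain ⟨δ, hδ, hδU⟩ := hUnhds μ hμ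
  refine ⟨min δ ρ, lt_min hδ hρ0, fun γ hγ hγ0 hdec => ?_⟩
  have hball : ∀ t, 0 ≤ t → dist (γ t) a < ρ := by
    intro t ht
    by_contra! hcon
    obtain ⟨T, hT, hTρ, hTle⟩ := exists_first_hitting_time (g := fun t => dist (γ t) a) ht
      ((continuous_id.dist continuous_const).comp_continuousOn (hγ.mono Icc_subset_Ici_self))
      (lt_of_lt_of_le hγ0 (min_le_right _ _)) hcon
    have hd := hdec T hT.1 fun s hs => (hTle s hs).trans (min_le_right _ _)
    have hle := le_sub_mul_of_hasDerivWithinAt_le (g := fun t => U (γ t)) (d := 0) hT.1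
      fun s hs => by
        obtain ⟨hs1, u', hu', hle⟩ := hd s hs
        exact ⟨u', hu', by linarith [hD0 _ ⟨(hTle s hs).trans (min_le_right _ _), hs1⟩]⟩
    have h1 := hδU (γ 0) (Metric.ball_subset_ball (min_le_left _ _) hγ0)
    have h2 := hμU (γ T) ⟨(hTle T ⟨hT.1, le_rfl⟩).trans (min_le_right _ _),
      (hd T ⟨hT.1, le_rfl⟩).1⟩ hTρ.ge
    simp only [zero_mul, sub_zero] at hle
    linarith
  have hcb : ∀ t, 0 ≤ t → γ t ∈ Metric.closedBall a R := fun t ht =>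
    (hball t ht).le.trans (min_le_right _ _)
  have hd : ∀ t, 0 ≤ t → γ t ∈ S ∧
      ∃ u', HasDerivWithinAt (fun t => U (γ t)) u' (Ici 0) t ∧ u' ≤ -D (γ t) := fun t ht =>
    hdec t ht (fun s hs => hcb s hs.1) t ⟨ht, le_rfl⟩
  refine ⟨fun t ht => ⟨lt_of_lt_of_le (hball t ht) (min_le_left _ _), (hd t ht).1⟩, ?_⟩
  have hanti : AntitoneOn (fun t => U (γ t)) (Ici 0) := by
    refine antitoneOn_of_deriv_nonpos (convex_Ici 0)
      (fun t ht => by obtain ⟨_, u', hu', _⟩ := hd t ht; exact hu'.continuousWithinAt) ?_ ?_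
    · rw [interior_Ici]
      intro t ht
      obtain ⟨_, u', hu', _⟩ := hd t (le_of_lt ht)
      exact (hu'.hasDerivAt (Ici_mem_nhds ht)).differentiableAt.differentiableWithinAt
    · rw [interior_Ici]
      intro t ht
      obtain ⟨hs, u', hu', hle⟩ := hd t (le_of_lt ht)
      rw [(hu'.hasDerivAt (Ici_mem_nhds ht)).deriv]
      linarith [hD0 _ ⟨hcb t (le_of_lt ht), hs⟩]
  rw [Metric.tendsto_atTop]
  intro η hη
  obtain ⟨μ', hμ', hμU'⟩ := key η hη U hUc fun z hz h => (hpos z hz h).1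
  obtain ⟨δ', hδ', hδU'⟩ := hUnhds μ' hμ'
  obtain ⟨d, hd0, hdD⟩ := key δ' hδ' D hDc fun z hz h => (hpos z hz h).2
  -- If `U` stayed above `μ'`, the curve would stay away from `a` and `U` would decrease linearly.
  obtain ⟨t₀, ht₀, hlt⟩ : ∃ t₀, 0 ≤ t₀ ∧ U (γ t₀) < μ' := by
    by_contra! hcon
    have hlin : ∀ T, 0 ≤ T → U (γ T) ≤ U (γ 0) - d * T := fun T hT =>
      le_sub_mul_of_hasDerivWithinAt_le (g := fun t => U (γ t)) hT fun s hs => by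
        obtain ⟨hs1, u', hu', hle⟩ := hd s hs.1
        refine ⟨u', hu', hle.trans (neg_le_neg (hdD _ ⟨hcb s hs.1, hs1⟩ ?_))⟩
        by_contra! h
        exact absurd (hδU' _ h) (not_lt.2 (hcon s hs.1))
    have hU00 := hU0 _ ⟨hcb 0 le_rfl, (hd 0 le_rfl).1⟩
    have := hlin (U (γ 0) / d) (by positivity)
    have h2 := hcon (U (γ 0) / d) (by positivity)
    rw [mul_div_cancel₀ _ hd0.ne'] at this
    linarith
  refine ⟨t₀, fun t ht => ?_⟩
  by_contra! hcon
  have ht0 : 0 ≤ t := ht₀.trans ht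
  have h1 := hμU' _ ⟨hcb t ht0, (hd t ht0).1⟩ hcon
  have h2 : U (γ t) ≤ U (γ t₀) := hanti ht₀ ht0 ht
  linarith

/-! ### The quadratic Lyapunov function of the linearization -/

theorem gronwallBound_zero_eq_mul (K ε x : ℝ) :
    gronwallBound 0 K ε x = ε * gronwallBound 0 K 1 x := by
  unfold gronwallBound
  split_ifs <;> ring

/-- If the equilibrium `xe` is globally exponentially stable, the flow of the linearization at
`xe` is a contraction at some time `T`: after rescaling, the linear flow is the limit of
trajectories that start closer and closer to `xe`. -/
theorem IsGESEquilibrium.exists_norm_exp_apply_le {n m : ℕ} {f : Euc n × Euc m → Euc n}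
    {u : Euc m} {xe : Euc n} (hges : IsGESEquilibrium f u xe) {A : Euc n →L[ℝ] Euc n}
    (hA : HasFDerivAt (fun x => f (x, u)) A xe) :
    ∃ T : ℝ, 0 < T ∧ ∀ v, ‖NormedSpace.exp (T • A) v‖ ≤ 1 / 2 * ‖v‖ := by
  obtain ⟨h0, hex, M, hM, ρ, hρ, hdecay⟩ := hges
  obtain ⟨T, hT, hTM⟩ : ∃ T : ℝ, 0 < T ∧ M * Real.exp (-ρ * T) ≤ 1 / 4 := by
    have h1 : Tendsto (fun T : ℝ => M * Real.exp (-ρ * T)) atTop (𝓝 (M * 0)) := by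
      refine (Real.tendsto_exp_atBot.comp ?_).const_mul M
      exact tendsto_id.const_mul_atTop_of_neg (by linarith)
    rw [mul_zero] at h1
    obtain ⟨T, h2, h3⟩ := ((h1.eventually_le_const (by norm_num : (0 : ℝ) < 1 / 4)).and
      (eventually_gt_atTop (0 : ℝ))).exists
    exact ⟨T, h3, h2⟩
  set C := gronwallBound 0 ‖A‖₊ 1 T with hC
  have hC0 : 0 ≤ C := by
    have := gronwallBound_mono (δ := 0) (ε := 1) (K := ‖A‖₊) le_rfl zero_le_one
      (by positivity) hT.le
    rwa [gronwallBound_x0] at this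
  obtain ⟨η, hη, hηC⟩ : ∃ η > 0, η * M * C ≤ 1 / 4 := by
    refine ⟨1 / (4 * (M * C + 1)), by positivity, ?_⟩
    rw [mul_assoc, div_mul_eq_mul_div, div_le_div_iff₀ (by positivity) (by norm_num)]
    nlinarith [mul_nonneg hM.le hC0]
  obtain ⟨r, hr, hrη⟩ : ∃ r > 0, ∀ y ∈ Metric.ball xe r,
      ‖f (y, u) - A (y - xe)‖ ≤ η * ‖y - xe‖ := by
    have := hA.isLittleO.def hη
    simpa [h0] using Metric.eventually_nhds_iff_ball.1 this
  refine ⟨T, hT, fun v => ?_⟩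
  obtain ⟨s, hs, hsr⟩ : ∃ s > 0, M * (s * ‖v‖) < r := by
    refine ⟨r / (2 * (M * ‖v‖ + 1)), by positivity, ?_⟩
    have : 0 ≤ M * ‖v‖ := by positivity
    rw [show M * (r / (2 * (M * ‖v‖ + 1)) * ‖v‖) = r * (M * ‖v‖) / (2 * (M * ‖v‖ + 1)) by ring,
      div_lt_iff₀ (by positivity)]
    nlinarith
  obtain ⟨ξ, hξ, hξ0⟩ := hex (xe + s • v)
  have hinit : ‖ξ 0 - xe‖ = s * ‖v‖ := by
    rw [hξ0, add_sub_cancel_left, norm_smul, Real.norm_of_nonneg hs.le]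
  have hbound : ∀ t, 0 ≤ t → ‖ξ t - xe‖ ≤ M * (s * ‖v‖) := by
    intro t ht
    refine (hdecay ξ hξ t ht).trans ?_
    rw [hinit]
    have : Real.exp (-ρ * t) ≤ 1 := Real.exp_le_one_iff.2 (by nlinarith)
    nlinarith [mul_nonneg hM.le (mul_nonneg hs.le (norm_nonneg v))]
  have hlin : ∀ t, HasDerivAt (fun t : ℝ => NormedSpace.exp (t • A) (s • v))
      (A (NormedSpace.exp (t • A) (s • v))) t := fun t =>
    (ContinuousLinearMap.apply ℝ (Euc n) (s • v)).hasFDerivAt.comp_hasDerivAt t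
      (hasDerivAt_exp_smul_const' A t)
  have hzero : NormedSpace.exp ((0 : ℝ) • A) (s • v) = s • v := by
    rw [zero_smul ℝ A, NormedSpace.exp_zero, one_apply_eq_self]
  have hgr := dist_le_of_approx_trajectories_ODE (v := fun _ => A) (K := ‖A‖₊)
    (f := fun t => ξ t - xe) (f' := fun t => f (ξ t, u)) (a := 0) (b := T)
    (g := fun t => NormedSpace.exp (t • A) (s • v))
    (g' := fun t => A (NormedSpace.exp (t • A) (s • v)))
    (εf := η * (M * (s * ‖v‖))) (εg := 0) (δ := 0) (fun _ => A.lipschitz)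
    (fun t ht => ((hξ t ht.1).continuousWithinAt.mono Icc_subset_Ici_self).sub
      continuousWithinAt_const)
    (fun t ht => ((hξ t ht.1).mono (Ici_subset_Ici.2 ht.1)).sub_const xe)
    (fun t ht => by
      rw [dist_eq_norm]
      have hb := hbound t ht.1
      refine (hrη (ξ t) ?_).trans (mul_le_mul_of_nonneg_left hb hη.le)
      rw [mem_ball_iff_norm]
      exact hb.trans_lt hsr)
    (fun t _ => (hlin t).continuousAt.continuousWithinAt)
    (fun t _ => (hlin t).hasDerivWithinAt)
    (fun t _ => by simp) (by
      rw [hξ0, add_sub_cancel_left]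
      exact (dist_eq_zero.2 hzero.symm).le) T ⟨hT.le, le_rfl⟩
  rw [add_zero, sub_zero, gronwallBound_zero_eq_mul, ← hC, map_smul] at hgr
  have h1 : ‖s • NormedSpace.exp (T • A) v‖ ≤ ‖ξ T - xe‖ + η * (M * (s * ‖v‖)) * C := by
    have := norm_sub_norm_le (s • NormedSpace.exp (T • A) v) (ξ T - xe)
    rw [← dist_eq_norm (s • _), dist_comm] at this
    linarith
  rw [norm_smul, Real.norm_of_nonneg hs.le] at h1
  have h2 := hdecay ξ hξ T hT.le
  rw [hinit] at h2
  have hsv : 0 ≤ s * ‖v‖ := by positivity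
  have h3 : s * ‖NormedSpace.exp (T • A) v‖ ≤ s * (1 / 2 * ‖v‖) := by
    nlinarith [mul_le_mul_of_nonneg_right hTM hsv, mul_le_mul_of_nonneg_right hηC hsv]
  exact le_of_mul_le_mul_left h3 hs

/-- Lyapunov's equation: if the flow of `A` is a contraction at some time `T`, then
`P = ∫₀ᵀ (exp tA)ᵀ (exp tA) dt` is a positive definite operator that decreases along the flow. -/
theorem exists_lyapunov_operator {E : Type*} [NormedAddCommGroup E] [InnerProductSpace ℝ E]
    [CompleteSpace E] {A : E →L[ℝ] E} {T : ℝ} (hT : 0 < T)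
    (hA : ∀ v, ‖NormedSpace.exp (T • A) v‖ ≤ 1 / 2 * ‖v‖) :
    ∃ P : E →L[ℝ] E, (∀ x y, inner ℝ (P x) y = inner ℝ (P y) x) ∧
      (∀ x, x ≠ 0 → 0 < inner ℝ (P x) x) ∧ ∀ x, inner ℝ (P x) (A x) ≤ -(3 / 8) * ‖x‖ ^ 2 := by
  have hd : ∀ x t, HasDerivAt (fun t : ℝ => NormedSpace.exp (t • A) x)
      (NormedSpace.exp (t • A) (A x)) t := fun x t =>
    (ContinuousLinearMap.apply ℝ E x).hasFDerivAt.comp_hasDerivAt t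
      (hasDerivAt_exp_smul_const A t)
  have hc : ∀ x, Continuous fun t : ℝ => NormedSpace.exp (t • A) x := fun x =>
    continuous_iff_continuousAt.2 fun t => (hd x t).continuousAt
  have hcexp : Continuous fun t : ℝ => NormedSpace.exp (t • A) :=
    continuous_iff_continuousAt.2 fun t => (hasDerivAt_exp_smul_const A t).continuousAt
  set G : ℝ → E →L[ℝ] E := fun t =>
    (ContinuousLinearMap.adjoint (NormedSpace.exp (t • A))).comp (NormedSpace.exp (t • A)) with hG
  have hGc : Continuous G :=
    ((ContinuousLinearMap.adjoint (𝕜 := ℝ) (E := E) (F := E)).continuous.comp hcexp).clm_comp hcexp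
  set P : E →L[ℝ] E := ∫ t in (0 : ℝ)..T, G t with hP
  have hPinner : ∀ x y, inner ℝ (P x) y =
      ∫ t in (0 : ℝ)..T, inner ℝ (NormedSpace.exp (t • A) x) (NormedSpace.exp (t • A) y) := by
    intro x y
    have := ContinuousLinearMap.intervalIntegral_comp_comm
      (μ := MeasureTheory.volume) ((innerSL ℝ y).comp (ContinuousLinearMap.apply ℝ E x))
      (hGc.intervalIntegrable 0 T)
    rw [real_inner_comm]
    refine this.symm.trans ?_
    congr 1
    funext t
    simp [hG, ContinuousLinearMap.adjoint_inner_right, real_inner_comm]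
  refine ⟨P, fun x y => ?_, fun x hx => ?_, fun x => ?_⟩
  · rw [hPinner, hPinner]
    congr 1
    funext t
    exact real_inner_comm _ _
  · rw [hPinner]
    have hci : Continuous fun t : ℝ =>
        inner ℝ (NormedSpace.exp (t • A) x) (NormedSpace.exp (t • A) x) :=
      (hc x).inner (hc x)
    refine intervalIntegral.integral_pos hT hci.continuousOn
      (fun t _ => real_inner_self_nonneg) ⟨0, ⟨le_rfl, hT.le⟩, ?_⟩
    simpa [NormedSpace.exp_zero] using pow_pos (norm_pos_iff.2 hx) 2
  · have hder : ∀ t, HasDerivAt (fun t : ℝ => (2 : ℝ)⁻¹ * ‖NormedSpace.exp (t • A) x‖ ^ 2)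
        (inner ℝ (NormedSpace.exp (t • A) x) (NormedSpace.exp (t • A) (A x))) t := by
      intro t
      have := ((hd x t).norm_sq).const_mul (2 : ℝ)⁻¹
      rwa [← mul_assoc, inv_mul_cancel₀ two_ne_zero, one_mul] at this
    rw [hPinner, intervalIntegral.integral_eq_sub_of_hasDerivAt (fun t _ => hder t)
      (((hc x).inner (hc (A x))).intervalIntegrable 0 T)]
    have h1 := hA x
    have h2 : ‖NormedSpace.exp (T • A) x‖ ^ 2 ≤ (1 / 2 * ‖x‖) ^ 2 :=
      pow_le_pow_left₀ (norm_nonneg _) h1 2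
    simp only [zero_smul, NormedSpace.exp_zero, one_apply_eq_self]
    nlinarith

/-! ### First-order conditions with one inequality constraint -/

theorem HasDerivAt.eventually_lt_nhdsGT {φ : ℝ → ℝ} {φ' : ℝ} (hφ : HasDerivAt φ φ' 0)
    (hpos : 0 < φ') : ∀ᶠ t in 𝓝[>] 0, φ 0 < φ t := by
  have h := (hasDerivWithinAt_iff_tendsto_slope' self_notMem_Ioi).1
    (hφ.hasDerivWithinAt (s := Ioi 0))
  filter_upwards [h.eventually_const_lt hpos, self_mem_nhdsWithin] with t ht ht0
  rw [slope_def_field, sub_zero] at ht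
  have := (div_pos_iff_of_pos_right ht0).1 ht
  linarith

/-- The Karush-Kuhn-Tucker conditions at a local minimum of `V` on `{b ≥ 0}`. If the gradients
`g` of `V` and `a` of `b` are not positively proportional, then `‖g‖ a - ‖a‖ g` is a direction
along which `b` increases and `V` decreases. -/
theorem exists_multiplier_of_local_min {E : Type*} [NormedAddCommGroup E] [InnerProductSpace ℝ E]
    [CompleteSpace E] {V b : E → ℝ} {u g a : E} (hV : HasGradientAt V g u)
    (hb : HasGradientAt b a u) (hbu : 0 ≤ b u) (hreg : b u = 0 → a ≠ 0)
    (hmin : ∀ᶠ v in 𝓝 u, 0 ≤ b v → V u ≤ V v) :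
    ∃ lam : ℝ, 0 ≤ lam ∧ g = lam • a ∧ lam * b u = 0 := by
  rcases hbu.lt_or_eq with hpos | hzero
  · refine ⟨0, le_rfl, ?_, zero_mul _⟩
    have hloc : IsLocalMin V u := by
      have hev : ∀ᶠ v in 𝓝 u, 0 < b v :=
        hb.differentiableAt.continuousAt.eventually_const_lt hpos
      filter_upwards [hmin, hev] with v hv hv' using hv hv'.le
    have := hloc.hasFDerivAt_eq_zero hV.hasFDerivAt
    rw [zero_smul]
    simpa using this
  · have ha := hreg hzero.symm
    by_contra! hcon
    have hne : ∀ lam : ℝ, 0 ≤ lam → g ≠ lam • a := fun lam hlam h =>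
      hcon lam hlam h (by rw [← hzero, mul_zero])
    have hg : g ≠ 0 := fun h => hne 0 le_rfl (by rw [h, zero_smul])
    have hg' := norm_pos_iff.2 hg
    have ha' := norm_pos_iff.2 ha
    have hlt : inner ℝ g a < ‖g‖ * ‖a‖ := by
      refine lt_of_le_of_ne (real_inner_le_norm g a) fun h => ?_
      refine hne (‖g‖ / ‖a‖) (by positivity) ?_
      rw [inner_eq_norm_mul_iff_real] at h
      rw [div_eq_inv_mul, mul_smul, ← h, smul_smul, inv_mul_cancel₀ ha'.ne', one_smul]
    set d : E := ‖g‖ • a - ‖a‖ • g with hd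
    have hline : ∀ {W : E → ℝ} {c : E}, HasGradientAt W c u →
        HasDerivAt (fun t : ℝ => W (u + t • d)) (inner ℝ c d) 0 := by
      intro W c hW
      have h1 : HasDerivAt (fun t : ℝ => u + t • d) d 0 := by
        simpa using ((hasDerivAt_id (0 : ℝ)).smul_const d).const_add u
      have h2 : HasFDerivAt W (InnerProductSpace.toDual ℝ E c) (u + (0 : ℝ) • d) := by
        simpa using hW.hasFDerivAt
      have h3 := h2.comp_hasDerivAt 0 h1
      rw [InnerProductSpace.toDual_apply_apply] at h3
      exact h3
    have hbd : 0 < inner ℝ a d := by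
      rw [hd, inner_sub_right, inner_smul_right, inner_smul_right, real_inner_self_eq_norm_sq,
        real_inner_comm]
      nlinarith [mul_pos ha' (sub_pos.2 hlt)]
    have hVd : 0 < -inner ℝ g d := by
      rw [hd, inner_sub_right, inner_smul_right, inner_smul_right, real_inner_self_eq_norm_sq]
      nlinarith [mul_pos hg' (sub_pos.2 hlt)]
    have hcurve : Tendsto (fun t : ℝ => u + t • d) (𝓝[>] 0) (𝓝 u) := by
      have : Continuous fun t : ℝ => u + t • d := by fun_prop
      have h := this.tendsto 0
      rw [zero_smul, add_zero] at h
      exact h.mono_left nhdsWithin_le_nhds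
    obtain ⟨t, h1, h2, h3⟩ := ((hline hb).eventually_lt_nhdsGT hbd).and
      (((hline hV).fun_neg.eventually_lt_nhdsGT hVd).and (hcurve.eventually hmin)) |>.exists
    simp only [zero_smul, add_zero] at h1 h2
    have := h3 (by linarith)
    linarith

/-! ### Projection onto a half-space -/

section HalfspaceProj

variable {E : Type*} [NormedAddCommGroup E] [InnerProductSpace ℝ E]

/-- The projection of `p` onto the half-space of the `q` with `⟪a, q⟫ ≥ c`. For `a = 0` the formula
gives `p`, which is the right value as long as `c ≤ 0`. -/
noncomputable def halfspaceProj (p a : E) (c : ℝ) : E :=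
  p + (max 0 (c - inner ℝ a p) / ‖a‖ ^ 2) • a

theorem inner_halfspaceProj {p a : E} (c : ℝ) (ha : a ≠ 0) :
    inner ℝ a (halfspaceProj p a c) = inner ℝ a p + max 0 (c - inner ℝ a p) := by
  have : ‖a‖ ^ 2 ≠ 0 := by positivity
  rw [halfspaceProj, inner_add_right, inner_smul_right, real_inner_self_eq_norm_sq,
    div_mul_cancel₀ _ this]

theorem le_inner_halfspaceProj {p a : E} {c : ℝ} (h : a ≠ 0 ∨ c ≤ 0) :
    c ≤ inner ℝ a (halfspaceProj p a c) := by
  by_cases ha : a = 0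
  · simpa [ha] using h
  · rw [inner_halfspaceProj c ha]
    linarith [le_max_right 0 (c - inner ℝ a p)]

/-- The variational inequality of the projection. -/
theorem inner_sub_halfspaceProj_nonpos (p : E) {a q : E} {c : ℝ} (hq : c ≤ inner ℝ a q) :
    inner ℝ (p - halfspaceProj p a c) (q - halfspaceProj p a c) ≤ 0 := by
  by_cases ha : a = 0
  · simp [halfspaceProj, ha]
  · have h1 : p - halfspaceProj p a c = -((max 0 (c - inner ℝ a p) / ‖a‖ ^ 2) • a) := by
      simp [halfspaceProj]
    rw [h1, inner_neg_left, real_inner_smul_left, inner_sub_right, inner_halfspaceProj c ha,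
      neg_nonpos]
    rcases le_total (c - inner ℝ a p) 0 with h | h
    · simp [max_eq_left h]
    · rw [max_eq_right h]
      have : 0 ≤ inner ℝ a q - (inner ℝ a p + (c - inner ℝ a p)) := by linarith
      positivity

/-- The multiplier of a vanishing projection of a negative multiple of `g`. -/
theorem exists_multiplier_of_halfspaceProj_eq_zero {g a : E} {c ε : ℝ} (hε : 0 < ε)
    (h : halfspaceProj (-(ε • g)) a c = 0) :
    ∃ lam : ℝ, 0 ≤ lam ∧ g = lam • a ∧ lam * c = 0 := by
  set s := max 0 (c - inner ℝ a (-(ε • g))) with hs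
  have hs0 : 0 ≤ s := le_max_left _ _
  have hg : ε • g = (s / ‖a‖ ^ 2) • a := by
    rw [halfspaceProj, neg_add_eq_zero] at h
    exact h
  refine ⟨s / ‖a‖ ^ 2 / ε, by positivity, ?_, ?_⟩
  · rw [div_eq_inv_mul, mul_smul, ← hg, smul_smul, inv_mul_cancel₀ hε.ne', one_smul]
  · by_cases ha : a = 0
    · simp [ha]
    · rcases hs0.lt_or_eq with hpos | hzero
      · have h1 := inner_halfspaceProj (p := -(ε • g)) c ha
        rw [h, inner_zero_right, ← hs] at h1
        have h2 : s = c - inner ℝ a (-(ε • g)) :=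
          max_eq_right (le_of_lt ((lt_max_iff.1 hpos).resolve_left (lt_irrefl 0)))
        rw [show c = 0 by linarith, mul_zero]
      · simp [← hzero]

theorem halfspaceProj_eq_zero {a : E} {c ε lam : ℝ} (hε : 0 < ε) (hc : c ≤ 0)
    (hlam : 0 ≤ lam) (hlc : lam * c = 0) : halfspaceProj (-(ε • lam • a)) a c = 0 := by
  by_cases ha : a = 0
  · simp [halfspaceProj, ha]
  · have hna : ‖a‖ ^ 2 ≠ 0 := by positivity
    rcases mul_eq_zero.1 hlc with h | h
    · simp [halfspaceProj, h, max_eq_left hc]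
    · have h1 : c - inner ℝ a (-(ε • lam • a)) = ε * lam * ‖a‖ ^ 2 := by
        rw [inner_neg_right, real_inner_smul_right, real_inner_smul_right,
          real_inner_self_eq_norm_sq, h]
        ring
      have h2 : 0 ≤ ε * lam * ‖a‖ ^ 2 := by positivity
      rw [halfspaceProj, h1, max_eq_right h2, mul_div_cancel_right₀ _ hna, mul_smul,
        neg_add_cancel]

open scoped NNReal in
theorem exists_lipschitzOnWith_halfspaceProj {a₀ : E} (ha₀ : a₀ ≠ 0) (p₀ : E) (c₀ : ℝ) :
    ∃ K : ℝ≥0, ∃ s ∈ 𝓝 (p₀, a₀, c₀),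
      LipschitzOnWith K (fun θ : E × E × ℝ => halfspaceProj θ.1 θ.2.1 θ.2.2) s := by
  let σ : E × E × ℝ → E × E × ℝ := fun θ => (θ.1, θ.2.1, max 0 (θ.2.2 - inner ℝ θ.2.1 θ.1))
  have hσ : LocallyLipschitz σ := by
    have h1 : ContDiff ℝ 1 fun θ : E × E × ℝ => θ.1 := contDiff_fst
    have h2 : ContDiff ℝ 1 fun θ : E × E × ℝ => θ.2.1 := contDiff_fst.comp contDiff_snd
    have h3 : ContDiff ℝ 1 fun θ : E × E × ℝ => θ.2.2 - inner ℝ θ.2.1 θ.1 :=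
      (contDiff_snd.comp contDiff_snd).sub (h2.inner ℝ h1)
    exact h1.locallyLipschitz.prodMk (h2.locallyLipschitz.prodMk (h3.locallyLipschitz.const_max 0))
  have hΨ : ContDiffAt ℝ 1 (fun θ : E × E × ℝ => θ.1 + (θ.2.2 / ‖θ.2.1‖ ^ 2) • θ.2.1)
      (σ (p₀, a₀, c₀)) := by
    have h2 : ContDiff ℝ 1 fun θ : E × E × ℝ => θ.2.1 := contDiff_fst.comp contDiff_snd
    have h3 : ContDiff ℝ 1 fun θ : E × E × ℝ => θ.2.2 := contDiff_snd.comp contDiff_snd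
    refine contDiffAt_fst.add (ContDiffAt.smul ?_ h2.contDiffAt)
    exact h3.contDiffAt.div (h2.norm_sq ℝ).contDiffAt
      (pow_ne_zero 2 (norm_ne_zero_iff.2 ha₀))
  obtain ⟨K₁, s₁, hs₁, hK₁⟩ := hΨ.exists_lipschitzOnWith
  obtain ⟨K₂, s₂, hs₂, hK₂⟩ := hσ (p₀, a₀, c₀)
  refine ⟨K₁ * K₂, s₂ ∩ σ ⁻¹' s₁, inter_mem hs₂ (hσ.continuous.continuousAt hs₁), ?_⟩
  exact hK₁.comp (hK₂.mono inter_subset_left) fun θ hθ => hθ.2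

end HalfspaceProj

/-! ### The functions `h_i` near a steady state -/

theorem hasFDerivAt_partial_fst {X Y F : Type*} [NormedAddCommGroup X] [NormedSpace ℝ X]
    [NormedAddCommGroup Y] [NormedSpace ℝ Y] [NormedAddCommGroup F] [NormedSpace ℝ F]
    {g : X × Y → F} {z : X × Y} (hg : DifferentiableAt ℝ g z) :
    HasFDerivAt (fun x => g (x, z.2)) ((fderiv ℝ g z).comp (.inl ℝ X Y)) z.1 :=
  HasFDerivAt.comp (g := g) z.1 hg.hasFDerivAt (hasFDerivAt_prodMk_left z.1 z.2)

theorem hasFDerivAt_partial_snd {X Y F : Type*} [NormedAddCommGroup X] [NormedSpace ℝ X]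
    [NormedAddCommGroup Y] [NormedSpace ℝ Y] [NormedAddCommGroup F] [NormedSpace ℝ F]
    {g : X × Y → F} {z : X × Y} (hg : DifferentiableAt ℝ g z) :
    HasFDerivAt (fun y => g (z.1, y)) ((fderiv ℝ g z).comp (.inr ℝ X Y)) z.2 :=
  HasFDerivAt.comp (g := g) z.2 hg.hasFDerivAt (hasFDerivAt_prodMk_right z.1 z.2)

section ClosedLoop

variable {n m : ℕ} {f : Euc n × Euc m → Euc n} {w : Euc m → Euc n} {h : Euc n → ℝ}
  {b : Euc m → ℝ} {Φ : Euc n → ℝ} {β : ℝ} {r : ℕ} {ε α γ : ℝ} {xs : Euc n} {us : Euc m}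

/-- Each `h_i` has one derivative less than its predecessor. -/
theorem contDiff_hcbf {N : ℕ} (hf : ContDiff ℝ N f) (i k : ℕ) (hk : k + i ≤ N + 1)
    (hh : ContDiff ℝ (k + i : ℕ) h) : ContDiff ℝ k (hcbf f h β i) := by
  induction i generalizing k with
  | zero => exact hh.comp contDiff_fst
  | succ i ih =>
    have h1 : ContDiff ℝ ((k + 1 : ℕ) : WithTop ℕ∞) (hcbf f h β i) :=
      ih (k + 1) (by omega) (by rwa [show k + 1 + i = k + (i + 1) by omega])
    have h2 : ContDiff ℝ k (fderiv ℝ (hcbf f h β i)) :=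
      h1.fderiv_right (m := k) (by push_cast; exact le_rfl)
    have h3 : ContDiff ℝ k f := hf.of_le (by exact_mod_cast (by omega : k ≤ N))
    have hdiff : Differentiable ℝ (hcbf f h β i) :=
      h1.differentiable (by exact_mod_cast Nat.succ_ne_zero k)
    have heq : hcbf f h β (i + 1) = fun z =>
        fderiv ℝ (hcbf f h β i) z (f z, 0) + β * hcbf f h β i z := by
      funext z
      rw [hcbf, (hasFDerivAt_partial_fst (hdiff z)).fderiv]
      rfl
    rw [heq]
    exact (h2.clm_apply (h3.prodMk contDiff_const)).add
      (contDiff_const.mul (h1.of_le (by exact_mod_cast Nat.le_succ k)))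

theorem hcbf_eq_of_equilibrium (hf : f (xs, us) = 0) (i : ℕ) :
    hcbf f h β i (xs, us) = β ^ i * h xs := by
  induction i with
  | zero => simp [hcbf]
  | succ i ih => rw [hcbf, hf, map_zero, ih]; ring

namespace RelativeDegreeRegularity

theorem contDiff_hcbf_two (hreg : RelativeDegreeRegularity f w h b Φ β r) :
    ContDiff ℝ (2 : ℕ) (hcbf f h β r) :=
  contDiff_hcbf hreg.f_smooth r 2 (by omega) (by rw [add_comm]; exact hreg.h_smooth)

theorem differentiable_hcbf (hreg : RelativeDegreeRegularity f w h b Φ β r) :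
    Differentiable ℝ (hcbf f h β r) :=
  hreg.contDiff_hcbf_two.differentiable (by norm_num)

theorem continuous_fderiv_hcbf (hreg : RelativeDegreeRegularity f w h b Φ β r) :
    Continuous (fderiv ℝ (hcbf f h β r)) :=
  hreg.contDiff_hcbf_two.continuous_fderiv (by norm_num)

theorem continuous_dhcbfState (hreg : RelativeDegreeRegularity f w h b Φ β r) :
    Continuous (dhcbfState f h β r) := by
  have : dhcbfState f h β r = fun z =>
      (fderiv ℝ (hcbf f h β r) z).comp (.inl ℝ (Euc n) (Euc m)) :=
    funext fun z => (hasFDerivAt_partial_fst (hreg.differentiable_hcbf z)).fderiv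
  rw [this]
  exact hreg.continuous_fderiv_hcbf.clm_comp continuous_const

theorem continuous_dhcbfInput (hreg : RelativeDegreeRegularity f w h b Φ β r) :
    Continuous (dhcbfInput f h β r) := by
  have : dhcbfInput f h β r = fun z =>
      (fderiv ℝ (hcbf f h β r) z).comp (.inr ℝ (Euc n) (Euc m)) :=
    funext fun z => (hasFDerivAt_partial_snd (hreg.differentiable_hcbf z)).fderiv
  rw [this]
  exact hreg.continuous_fderiv_hcbf.clm_comp continuous_const

end RelativeDegreeRegularity

/-! ### Critical points of the feedback-optimization problem -/

/-- The gradient `∂w/∂u(u)ᵀ ∇Φ(x)` of the objective with respect to the input, with the state in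
place of its steady-state value. -/
noncomputable def inputGradient (w : Euc m → Euc n) (Φ : Euc n → ℝ) (z : Euc n × Euc m) : Euc m :=
  (ContinuousLinearMap.adjoint (fderiv ℝ w z.2)) (gradient Φ z.1)

theorem inner_inputGradient (z : Euc n × Euc m) (q : Euc m) :
    inner ℝ (inputGradient w Φ z) q = fderiv ℝ Φ z.1 (fderiv ℝ w z.2 q) := by
  rw [inputGradient, ContinuousLinearMap.adjoint_inner_left, inner_gradient_left]

theorem hasGradientAt_comp_steadyState {u : Euc m} (hΦ : DifferentiableAt ℝ Φ (w u))
    (hw : DifferentiableAt ℝ w u) :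
    HasGradientAt (fun v => Φ (w v)) (inputGradient w Φ (w u, u)) u := by
  rw [hasGradientAt_iff_hasFDerivAt]
  have heq : InnerProductSpace.toDual ℝ (Euc m) (inputGradient w Φ (w u, u)) =
      (fderiv ℝ Φ (w u)).comp (fderiv ℝ w u) := by
    refine ContinuousLinearMap.ext fun q => ?_
    rw [InnerProductSpace.toDual_apply_apply, inner_inputGradient]
    rfl
  rw [heq]
  exact hΦ.hasFDerivAt.comp u hw.hasFDerivAt

/-- A multiplier of the reduced problem `min Φ (w u)` subject to `b u ≥ 0` makes `(w u, u)` a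
critical point of the full problem. -/
theorem isCritical_of_multiplier (hreg : RelativeDegreeRegularity f w h b Φ β r) {u : Euc m}
    (hh : 0 ≤ h (w u)) (hb : 0 ≤ b u) {lam : ℝ} (hlam : 0 ≤ lam)
    (hgrad : inputGradient w Φ (w u, u) = lam • gradient b u) (hcomp : lam * b u = 0) :
    (feedbackProblem w h b Φ).IsCritical (w u, u) () := by
  have hΦd := hreg.Φ_smooth.differentiable two_ne_zero (w u)
  have hwd := hreg.w_smooth.differentiable two_ne_zero u
  have hbd := hreg.b_smooth.differentiable two_ne_zero u
  have hobj : HasFDerivAt (fun y : Euc n × Euc m => Φ y.1)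
      ((fderiv ℝ Φ (w u)).comp (.fst ℝ (Euc n) (Euc m))) (w u, u) :=
    HasFDerivAt.comp (g := Φ) (w u, u) hΦd.hasFDerivAt hasFDerivAt_fst
  have hineq : HasFDerivAt (fun y : Euc n × Euc m => b y.2)
      ((fderiv ℝ b u).comp (.snd ℝ (Euc n) (Euc m))) (w u, u) :=
    HasFDerivAt.comp (g := b) (w u, u) hbd.hasFDerivAt hasFDerivAt_snd
  have heqc : ∀ j, HasFDerivAt (fun y : Euc n × Euc m => y.1 j - w y.2 j)
      ((EuclideanSpace.proj j).comp (.fst ℝ (Euc n) (Euc m) -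
        (fderiv ℝ w u).comp (.snd ℝ (Euc n) (Euc m)))) (w u, u) := by
    intro j
    have h1 : HasFDerivAt (fun y : Euc n × Euc m => y.1 - w y.2)
        (.fst ℝ (Euc n) (Euc m) - (fderiv ℝ w u).comp (.snd ℝ (Euc n) (Euc m))) (w u, u) :=
      hasFDerivAt_fst.sub
        (HasFDerivAt.comp (g := w) (w u, u) hwd.hasFDerivAt hasFDerivAt_snd)
    exact (EuclideanSpace.proj (𝕜 := ℝ) j).hasFDerivAt.comp (w u, u) h1
  refine ⟨⟨fun i => ?_, fun j => sub_self _⟩, ![0, lam], fun j => -gradient Φ (w u) j, ?_, ?_, ?_⟩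
  · fin_cases i
    · exact hh
    · exact hb
  · have e1 : (feedbackProblem w h b Φ).dineq 1 (w u, u) () =
        (fderiv ℝ b u).comp (.snd ℝ (Euc n) (Euc m)) := hineq.fderiv
    have e2 : ∀ j, (feedbackProblem w h b Φ).deqc j (w u, u) () =
        (EuclideanSpace.proj j).comp (.fst ℝ (Euc n) (Euc m) -
        (fderiv ℝ w u).comp (.snd ℝ (Euc n) (Euc m))) := fun j => (heqc j).fderiv
    have e3 : fderiv ℝ (fun y => (feedbackProblem w h b Φ).obj y ()) (w u, u) =
        (fderiv ℝ Φ (w u)).comp (.fst ℝ (Euc n) (Euc m)) := hobj.fderiv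
    rw [e3, Fin.sum_univ_two, e1]
    simp only [e2]
    refine ContinuousLinearMap.ext fun v => ?_
    have hsum : ∑ j, gradient Φ (w u) j * (v.1 - fderiv ℝ w u v.2) j =
        fderiv ℝ Φ (w u) (v.1 - fderiv ℝ w u v.2) := by
      rw [← inner_gradient_left, PiLp.inner_apply]
      simp [mul_comm]
    have hsnd : fderiv ℝ Φ (w u) (fderiv ℝ w u v.2) = lam * fderiv ℝ b u v.2 := by
      rw [← inner_inputGradient (z := (w u, u)), hgrad, real_inner_smul_left, inner_gradient_left]
    rw [map_sub, hsnd] at hsum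
    simp only [PiLp.sub_apply] at hsum
    simp [hsum]
  · intro i
    fin_cases i
    · exact le_rfl
    · exact hlam
  · intro i
    fin_cases i
    · exact zero_mul _
    · exact hcomp

theorem exists_multiplier_of_reduced_local_min (hreg : RelativeDegreeRegularity f w h b Φ β r)
    {u : Euc m} (hh : 0 < h (w u)) (hb : 0 ≤ b u)
    (hmin : ∀ᶠ v in 𝓝 u, 0 ≤ b v → Φ (w u) ≤ Φ (w v)) :
    ∃ lam : ℝ, 0 ≤ lam ∧ inputGradient w Φ (w u, u) = lam • gradient b u ∧ lam * b u = 0 :=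
  exists_multiplier_of_local_min
    (hasGradientAt_comp_steadyState (hreg.Φ_smooth.differentiable two_ne_zero _)
      (hreg.w_smooth.differentiable two_ne_zero _))
    (hreg.b_smooth.differentiable two_ne_zero _).hasGradientAt hb
    (hreg.b_regular (w u, u) ⟨hb, hh.le⟩) hmin

theorem feedbackProblem_feasible_iff {z : Euc n × Euc m} :
    z ∈ (feedbackProblem w h b Φ).feasible () ↔ z.1 = w z.2 ∧ 0 ≤ h z.1 ∧ 0 ≤ b z.2 := by
  constructor
  · rintro ⟨h1, h2⟩
    refine ⟨?_, h1 0, h1 1⟩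
    ext j
    exact sub_eq_zero.1 (h2 j)
  · rintro ⟨h1, h2, h3⟩
    refine ⟨fun i => ?_, fun j => sub_eq_zero.2 (by rw [h1])⟩
    fin_cases i
    · exact h2
    · exact h3

/-- Where `h > 0`, a local optimum is a local minimum of `Φ (w u)` on `{b ≥ 0}`. -/
theorem eventually_le_of_isLocalOptimum (hw : Continuous w) (hh : Continuous h)
    (hopt : (feedbackProblem w h b Φ).IsLocalOptimum (xs, us) ()) (hpos : 0 < h xs) :
    ∀ᶠ v in 𝓝 us, 0 ≤ b v → Φ (w us) ≤ Φ (w v) := by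
  obtain ⟨hfeas, hloc⟩ := hopt
  obtain rfl : xs = w us := (feedbackProblem_feasible_iff.1 hfeas).1
  have hcont : Tendsto (fun v => (w v, v)) (𝓝 us) (𝓝 (w us, us)) :=
    (hw.prodMk continuous_id).tendsto us
  have hhpos : ∀ᶠ v in 𝓝 us, 0 < h (w v) :=
    (hh.comp hw).continuousAt.eventually_const_lt hpos
  filter_upwards [hcont.eventually (eventually_nhdsWithin_iff.1 hloc), hhpos] with v hv hv' hb
  exact hv (feedbackProblem_feasible_iff.2 ⟨rfl, hv'.le, hb⟩)

/-- An isolated critical point that is a local optimum is a strict one: a nearby point with the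
same value would be a local optimum too, hence critical. -/
theorem eventually_lt_of_isLocalOptimum (hreg : RelativeDegreeRegularity f w h b Φ β r)
    (hopt : (feedbackProblem w h b Φ).IsLocalOptimum (xs, us) ()) (hpos : 0 < h xs)
    {N : Set (Euc n × Euc m)} (hN : N ∈ 𝓝 (xs, us))
    (hcrit : ∀ z ∈ N, (feedbackProblem w h b Φ).IsCritical z () → z = (xs, us)) :
    ∀ᶠ v in 𝓝 us, 0 ≤ b v → v ≠ us → Φ (w us) < Φ (w v) := by
  have hmin := eventually_le_of_isLocalOptimum hreg.w_smooth.continuous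
    hreg.h_smooth.continuous hopt hpos
  obtain rfl : xs = w us := (feedbackProblem_feasible_iff.1 hopt.1).1
  have hcont : Tendsto (fun v => (w v, v)) (𝓝 us) (𝓝 (w us, us)) :=
    (hreg.w_smooth.continuous.prodMk continuous_id).tendsto us
  have hhpos : ∀ᶠ v in 𝓝 us, 0 < h (w v) :=
    (hreg.h_smooth.continuous.comp hreg.w_smooth.continuous).continuousAt.eventually_const_lt hpos
  filter_upwards [hmin.eventually_nhds, hhpos, hcont hN] with v hv hhv hNv hbv hne
  refine lt_of_le_of_ne (hv.self_of_nhds hbv) fun heq => hne ?_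
  obtain ⟨lam, h1, h2, h3⟩ := exists_multiplier_of_reduced_local_min hreg hhv hbv
    (by simpa only [← heq] using hv)
  exact congrArg Prod.snd (hcrit _ hNv (isCritical_of_multiplier hreg hhv.le hbv h1 h2 h3))

/-! ### The controller near the optimum -/

/-- The solution of the quadratic program when only the constraint on the input is active: the
projection of `-ε ∂w/∂uᵀ ∇Φ` onto the half-space `∇bᵀ q + α b ≥ 0`. -/
noncomputable def sgfControl (w : Euc m → Euc n) (b : Euc m → ℝ) (Φ : Euc n → ℝ) (ε α : ℝ)
    (z : Euc n × Euc m) : Euc m :=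
  halfspaceProj (-(ε • inputGradient w Φ z)) (gradient b z.2) (-(α * b z.2))

theorem sgfQP_isSolution_iff {z : Euc n × Euc m} {q : Euc m}
    (hz : gradient b z.2 ≠ 0 ∨ 0 ≤ α * b z.2)
    (hslack : 0 ≤ dhcbfState f h β r z (f z) + dhcbfInput f h β r z (sgfControl w b Φ ε α z)
      + γ * hcbf f h β r z) :
    (sgfQP f w h b Φ β r ε α γ).IsSolution q z ↔ q = sgfControl w b Φ ε α z := by
  set k := sgfControl w b Φ ε α z with hk
  set p := -(ε • inputGradient w Φ z) with hp
  have hobj : ∀ q, (sgfQP f w h b Φ β r ε α γ).obj q z = 1 / 2 * ‖q - p‖ ^ 2 := by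
    intro q
    rw [hp, sub_neg_eq_add]
    rfl
  have hkfeas : k ∈ (sgfQP f w h b Φ β r ε α γ).feasible z := by
    refine ⟨fun i => ?_, fun j => j.elim0⟩
    fin_cases i
    · have := le_inner_halfspaceProj (p := p) (a := gradient b z.2) (c := -(α * b z.2))
        (hz.imp id fun h => by linarith)
      exact neg_le_iff_add_nonneg.1 this
    · exact hslack
  have hdist : ∀ y ∈ (sgfQP f w h b Φ β r ε α γ).feasible z,
      ‖k - p‖ ^ 2 + ‖y - k‖ ^ 2 ≤ ‖y - p‖ ^ 2 := by
    intro y hy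
    have h1 : -(α * b z.2) ≤ inner ℝ (gradient b z.2) y := neg_le_iff_add_nonneg.2 (hy.1 0)
    have h2 : inner ℝ (p - k) (y - k) ≤ 0 := inner_sub_halfspaceProj_nonpos p h1
    have h3 := norm_sub_sq_real (y - k) (p - k)
    rw [sub_sub_sub_cancel_right, real_inner_comm, norm_sub_rev p k] at h3
    linarith
  constructor
  · rintro ⟨hq, hmin⟩
    have h1 := hmin k hkfeas
    rw [hobj, hobj] at h1
    have h2 := hdist q hq
    have h3 : ‖q - k‖ ^ 2 = 0 := le_antisymm (by linarith) (sq_nonneg _)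
    rwa [pow_eq_zero_iff two_ne_zero, norm_eq_zero, sub_eq_zero] at h3
  · rintro rfl
    refine ⟨hkfeas, fun y hy => ?_⟩
    rw [hobj, hobj]
    linarith [hdist y hy, sq_nonneg ‖y - k‖]

theorem norm_sgfControl_sq_le {z : Euc n × Euc m} (hα : 0 < α) (hb : 0 ≤ b z.2) :
    ‖sgfControl w b Φ ε α z‖ ^ 2 ≤
      -(ε * inner ℝ (inputGradient w Φ z) (sgfControl w b Φ ε α z)) := by
  have h1 : -(α * b z.2) ≤ inner ℝ (gradient b z.2) (0 : Euc m) := by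
    rw [inner_zero_right]
    linarith [mul_nonneg hα.le hb]
  have h2 := inner_sub_halfspaceProj_nonpos (-(ε • inputGradient w Φ z)) h1
  change inner ℝ (_ - sgfControl w b Φ ε α z) (0 - sgfControl w b Φ ε α z) ≤ 0 at h2
  rw [zero_sub, inner_neg_right, inner_sub_left, inner_neg_left, real_inner_smul_left,
    real_inner_self_eq_norm_sq] at h2
  linarith

theorem neg_le_inner_sgfControl {z : Euc n × Euc m} (hz : gradient b z.2 ≠ 0 ∨ 0 ≤ α * b z.2) :
    -(α * b z.2) ≤ fderiv ℝ b z.2 (sgfControl w b Φ ε α z) := by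
  rw [← inner_gradient_left]
  exact le_inner_halfspaceProj (hz.imp id fun h => by linarith)

theorem eventually_gradient_ne_zero_or (hreg : RelativeDegreeRegularity f w h b Φ β r)
    (hα : 0 < α) (hb : 0 ≤ b us) (hh : 0 ≤ h xs) :
    ∀ᶠ z : Euc n × Euc m in 𝓝 (xs, us), gradient b z.2 ≠ 0 ∨ 0 ≤ α * b z.2 := by
  rcases hb.lt_or_eq with hpos | hzero
  · have : ∀ᶠ z : Euc n × Euc m in 𝓝 (xs, us), 0 < b z.2 :=
      (hreg.b_smooth.continuous.comp continuous_snd).continuousAt.eventually_const_lt hpos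
    filter_upwards [this] with z hz using Or.inr (mul_pos hα hz).le
  · have hne := hreg.b_regular (xs, us) ⟨hb, hh⟩ hzero.symm
    have hcont : Continuous (gradient b) :=
      (InnerProductSpace.toDual ℝ (Euc m)).symm.continuous.comp
        (hreg.b_smooth.continuous_fderiv two_ne_zero)
    have : ∀ᶠ z : Euc n × Euc m in 𝓝 (xs, us), gradient b z.2 ≠ 0 :=
      (hcont.comp continuous_snd).continuousAt.eventually_ne hne
    filter_upwards [this] with z hz using Or.inl hz

theorem ContDiff.locallyLipschitz_gradient {E : Type*} [NormedAddCommGroup E]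
    [InnerProductSpace ℝ E] [CompleteSpace E] {g : E → ℝ} (hg : ContDiff ℝ 2 g) :
    LocallyLipschitz (gradient g) :=
  (InnerProductSpace.toDual ℝ E).symm.lipschitz.locallyLipschitz.comp
    (hg.fderiv_right (m := 1) (by norm_num)).locallyLipschitz

theorem locallyLipschitz_inputGradient (hw : ContDiff ℝ 2 w) (hΦ : ContDiff ℝ 2 Φ) :
    LocallyLipschitz (inputGradient w Φ) := by
  have hadj : LocallyLipschitz fun A : Euc m →L[ℝ] Euc n => ContinuousLinearMap.adjoint A :=
    LinearIsometryEquiv.lipschitz ContinuousLinearMap.adjoint |>.locallyLipschitz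
  have hdw : LocallyLipschitz (fderiv ℝ w) :=
    (hw.fderiv_right (m := 1) (by norm_num)).locallyLipschitz
  have h1 : LocallyLipschitz fun z : Euc n × Euc m =>
      ContinuousLinearMap.adjoint (fderiv ℝ w z.2) :=
    hadj.comp (hdw.comp LipschitzWith.prod_snd.locallyLipschitz)
  have h2 : LocallyLipschitz fun z : Euc n × Euc m => gradient Φ z.1 :=
    hΦ.locallyLipschitz_gradient.comp LipschitzWith.prod_fst.locallyLipschitz
  have h3 : ContDiff ℝ 1 fun p : (Euc n →L[ℝ] Euc m) × Euc n => p.1 p.2 :=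
    contDiff_fst.clm_apply contDiff_snd
  have h4 := h3.locallyLipschitz.comp (h1.prodMk h2)
  exact h4

open scoped NNReal in
theorem exists_lipschitzOnWith_sgfControl (hreg : RelativeDegreeRegularity f w h b Φ β r)
    (hα : 0 < α) (hb : 0 ≤ b us) (hh : 0 ≤ h xs) :
    ∃ K : ℝ≥0, ∃ s ∈ 𝓝 (xs, us), LipschitzOnWith K (sgfControl w b Φ ε α) s := by
  have hG := locallyLipschitz_inputGradient hreg.w_smooth hreg.Φ_smooth
  have hp : LocallyLipschitz fun z => -(ε • inputGradient w Φ z) :=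
    by simpa only [Function.comp_def, neg_smul] using
      (lipschitzWith_smul (-ε)).locallyLipschitz.comp hG
  have ha : LocallyLipschitz fun z : Euc n × Euc m => gradient b z.2 :=
    hreg.b_smooth.locallyLipschitz_gradient.comp LipschitzWith.prod_snd.locallyLipschitz
  have hc : LocallyLipschitz fun z : Euc n × Euc m => -(α * b z.2) :=
    ((contDiff_const.mul ((hreg.b_smooth.of_le one_le_two).comp contDiff_snd)).neg).locallyLipschitz
  by_cases hane : gradient b us = 0
  · -- Then `b us > 0`, and the constraint is inactive near `(xs, us)`.
    have hbpos : 0 < b us := lt_of_le_of_ne hb fun h0 =>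
      hreg.b_regular (xs, us) ⟨hb, hh⟩ h0.symm hane
    have hslack : ∀ᶠ z in 𝓝 (xs, us),
        -(α * b z.2) - inner ℝ (gradient b z.2) (-(ε • inputGradient w Φ z)) < 0 := by
      have hcont : Continuous fun z : Euc n × Euc m =>
          -(α * b z.2) - inner ℝ (gradient b z.2) (-(ε • inputGradient w Φ z)) :=
        hc.continuous.sub (ha.continuous.inner hp.continuous)
      refine hcont.continuousAt.eventually_lt continuousAt_const ?_
      rw [hane, inner_zero_left]
      linarith [mul_pos hα hbpos]
    obtain ⟨K, s, hs, hK⟩ := hp (xs, us)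
    refine ⟨K, _, inter_mem hs hslack, ?_⟩
    have heq : EqOn (sgfControl w b Φ ε α) (fun z => -(ε • inputGradient w Φ z))
        (s ∩ {z | -(α * b z.2) - inner ℝ (gradient b z.2) (-(ε • inputGradient w Φ z)) < 0}) := by
      intro z hz
      have : -(α * b z.2) - inner ℝ (gradient b z.2) (-(ε • inputGradient w Φ z)) ≤ 0 := hz.2.le
      simp only [sgfControl, halfspaceProj, max_eq_left this, zero_div, zero_smul, add_zero]
    intro x hx y hy
    rw [heq hx, heq hy]
    exact hK hx.1 hy.1
  · obtain ⟨K₁, s₁, hs₁, hK₁⟩ := exists_lipschitzOnWith_halfspaceProj hane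
      (-(ε • inputGradient w Φ (xs, us))) (-(α * b us))
    have hθ := hp.prodMk (ha.prodMk hc)
    obtain ⟨K₂, s₂, hs₂, hK₂⟩ := hθ (xs, us)
    refine ⟨K₁ * K₂, _, inter_mem hs₂ (hθ.continuous.continuousAt hs₁), ?_⟩
    have hcomp := hK₁.comp (hK₂.mono inter_subset_left) (fun z hz => hz.2 :
      MapsTo _ (s₂ ∩ (fun z => (-(ε • inputGradient w Φ z), gradient b z.2, -(α * b z.2))) ⁻¹' s₁)
        s₁)
    exact hcomp

/-! ### The decrease of the composite Lyapunov function -/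

/-- The composite Lyapunov function: the reduced objective plus a quadratic form in the deviation
of the state from its steady-state value. -/
noncomputable def compositeLyapunov (w : Euc m → Euc n) (Φ : Euc n → ℝ) (P : Euc n →L[ℝ] Euc n)
    (z : Euc n × Euc m) : ℝ :=
  Φ (w z.2) + inner ℝ (P (z.1 - w z.2)) (z.1 - w z.2)

theorem hasDerivWithinAt_compositeLyapunov (hw : Differentiable ℝ w) (hΦ : Differentiable ℝ Φ)
    {P : Euc n →L[ℝ] Euc n} (hP : ∀ x y, inner ℝ (P x) y = inner ℝ (P y) x)
    {ζ : ℝ → Euc n × Euc m} {v : Euc n × Euc m} {s : Set ℝ} {t : ℝ}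
    (hζ : HasDerivWithinAt ζ v s t) :
    HasDerivWithinAt (fun t => compositeLyapunov w Φ P (ζ t))
      (fderiv ℝ Φ (w (ζ t).2) (fderiv ℝ w (ζ t).2 v.2) +
        2 * inner ℝ (P ((ζ t).1 - w (ζ t).2)) (v.1 - fderiv ℝ w (ζ t).2 v.2)) s t := by
  have h1 : HasDerivWithinAt (fun t => (ζ t).1) v.1 s t :=
    (hasFDerivAt_fst (𝕜 := ℝ) (p := ζ t)).comp_hasDerivWithinAt t hζ
  have h2 : HasDerivWithinAt (fun t => (ζ t).2) v.2 s t :=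
    (hasFDerivAt_snd (𝕜 := ℝ) (p := ζ t)).comp_hasDerivWithinAt t hζ
  have h3 : HasDerivWithinAt (fun t => w (ζ t).2) (fderiv ℝ w (ζ t).2 v.2) s t :=
    (hw _).hasFDerivAt.comp_hasDerivWithinAt t h2
  have h4 : HasDerivWithinAt (fun t => Φ (w (ζ t).2))
      (fderiv ℝ Φ (w (ζ t).2) (fderiv ℝ w (ζ t).2 v.2)) s t :=
    (hΦ _).hasFDerivAt.comp_hasDerivWithinAt t h3
  have h5 := h1.fun_sub h3
  have h6 : HasDerivWithinAt (fun t => P ((ζ t).1 - w (ζ t).2))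
      (P (v.1 - fderiv ℝ w (ζ t).2 v.2)) s t :=
    P.hasFDerivAt.comp_hasDerivWithinAt t h5
  have h7 := h4.fun_add (h6.inner ℝ h5)
  rwa [hP (v.1 - _), ← two_mul] at h7

/-- The cross terms between the fast and the slow dynamics are bounded by a multiple of
`‖x - w u‖ ‖q‖`, and the fast dynamics contribute a negative definite term. -/
theorem exists_compositeLyapunov_bound (hstab : IsSteadyStateMap f w)
    (hreg : RelativeDegreeRegularity f w h b Φ β r) (us : Euc m) :
    ∃ (P : Euc n →L[ℝ] Euc n) (C : ℝ), 0 ≤ C ∧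
      (∀ x y, inner ℝ (P x) y = inner ℝ (P y) x) ∧ (∀ x, x ≠ 0 → 0 < inner ℝ (P x) x) ∧
      ∀ᶠ z in 𝓝 (w us, us), ∀ q : Euc m,
        fderiv ℝ Φ (w z.2) (fderiv ℝ w z.2 q) +
            2 * inner ℝ (P (z.1 - w z.2)) (f z - fderiv ℝ w z.2 q) ≤
          inner ℝ (inputGradient w Φ z) q + C * ‖z.1 - w z.2‖ * ‖q‖
            - 1 / 2 * ‖z.1 - w z.2‖ ^ 2 := by
  have hfst : HasStrictFDerivAt f (fderiv ℝ f (w us, us)) (w us, us) :=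
    hreg.f_smooth.contDiffAt.hasStrictFDerivAt (by exact_mod_cast Nat.succ_ne_zero r)
  set A := (fderiv ℝ f (w us, us)).comp (.inl ℝ (Euc n) (Euc m)) with hA
  obtain ⟨T, hT, hTA⟩ := (hstab us).1.exists_norm_exp_apply_le
    (hasFDerivAt_partial_fst (z := (w us, us)) hfst.hasFDerivAt.differentiableAt)
  obtain ⟨P, hsymm, hPpos, hPA⟩ := exists_lyapunov_operator hT hTA
  have hwc : Continuous w := hreg.w_smooth.continuous
  -- The fast dynamics.
  obtain ⟨η, hη, hηP⟩ : ∃ η > 0, ‖P‖ * η ≤ 1 / 8 := by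
    refine ⟨1 / (8 * (‖P‖ + 1)), by positivity, ?_⟩
    rw [mul_one_div, div_le_div_iff₀ (by positivity) (by norm_num)]
    linarith [norm_nonneg P]
  have hfast : ∀ᶠ z in 𝓝 (w us, us), inner ℝ (P (z.1 - w z.2)) (f z) ≤
      -(1 / 4) * ‖z.1 - w z.2‖ ^ 2 := by
    have hpair : Tendsto (fun z : Euc n × Euc m => (z, (w z.2, z.2))) (𝓝 (w us, us))
        (𝓝 ((w us, us), (w us, us))) := by
      have : Continuous fun z : Euc n × Euc m => (z, (w z.2, z.2)) := by fun_prop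
      exact this.tendsto (w us, us)
    filter_upwards [hpair.eventually (hfst.isLittleO.def hη)] with z hz
    have h1 : z - (w z.2, z.2) = (z.1 - w z.2, 0) := by ext1 <;> simp
    have h2 : fderiv ℝ f (w us, us) (z.1 - w z.2, 0) = A (z.1 - w z.2) := rfl
    rw [(hstab z.2).1.1, sub_zero, h1, h2, Prod.norm_mk, norm_zero,
      max_eq_left (norm_nonneg _)] at hz
    set y := z.1 - w z.2
    have h3 : inner ℝ (P y) (f z) = inner ℝ (P y) (A y) + inner ℝ (P y) (f z - A y) := by
      rw [← inner_add_right, add_sub_cancel]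
    have h4 : inner ℝ (P y) (f z - A y) ≤ ‖P‖ * η * ‖y‖ ^ 2 := by
      refine (real_inner_le_norm _ _).trans ?_
      calc ‖P y‖ * ‖f z - A y‖ ≤ (‖P‖ * ‖y‖) * (η * ‖y‖) :=
            mul_le_mul (P.le_opNorm y) hz (norm_nonneg _) (by positivity)
        _ = ‖P‖ * η * ‖y‖ ^ 2 := by ring
    rw [h3]
    nlinarith [hPA y, mul_le_mul_of_nonneg_right hηP (sq_nonneg ‖y‖)]
  -- The slow dynamics.
  obtain ⟨K, s, hs, hK⟩ :=
    (hreg.Φ_smooth.fderiv_right (m := 1) (by norm_num)).locallyLipschitz (w us)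
  set D := ‖fderiv ℝ w us‖ + 1 with hD
  have hDev : ∀ᶠ z : Euc n × Euc m in 𝓝 (w us, us), ‖fderiv ℝ w z.2‖ < D := by
    have : Continuous fun z : Euc n × Euc m => ‖fderiv ℝ w z.2‖ :=
      ((hreg.w_smooth.continuous_fderiv two_ne_zero).comp continuous_snd).norm
    exact this.continuousAt.eventually_lt continuousAt_const (by simp [hD])
  have hs1 : ∀ᶠ z : Euc n × Euc m in 𝓝 (w us, us), z.1 ∈ s :=
    continuous_fst.tendsto (w us, us) hs
  have hs2 : ∀ᶠ z : Euc n × Euc m in 𝓝 (w us, us), w z.2 ∈ s :=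
    (hwc.comp continuous_snd).tendsto (w us, us) hs
  refine ⟨P, K * D + 2 * ‖P‖ * D, by positivity, hsymm, hPpos, ?_⟩
  filter_upwards [hfast, hDev, hs1, hs2] with z hz1 hz2 hz3 hz4 q
  set y := z.1 - w z.2 with hy
  set Dq := fderiv ℝ w z.2 q with hDq
  have hDq' : ‖Dq‖ ≤ D * ‖q‖ :=
    ((fderiv ℝ w z.2).le_opNorm q).trans (mul_le_mul_of_nonneg_right hz2.le (norm_nonneg q))
  have h1 : fderiv ℝ Φ (w z.2) Dq - fderiv ℝ Φ z.1 Dq ≤ K * ‖y‖ * (D * ‖q‖) := by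
    rw [← sub_apply]
    refine (Real.le_norm_self _).trans (((_ : Euc n →L[ℝ] ℝ).le_opNorm Dq).trans ?_)
    refine mul_le_mul ?_ hDq' (norm_nonneg _) (by positivity)
    rw [← dist_eq_norm, hy, ← dist_eq_norm, dist_comm z.1]
    exact hK.dist_le_mul _ hz4 _ hz3
  have h2 : -inner ℝ (P y) Dq ≤ ‖P‖ * ‖y‖ * (D * ‖q‖) := by
    refine ((neg_le_abs _).trans (abs_real_inner_le_norm _ _)).trans ?_
    exact mul_le_mul (P.le_opNorm y) hDq' (norm_nonneg _) (by positivity)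
  rw [inner_inputGradient, inner_sub_right]
  nlinarith

/-! ### Asymptotic stability of the closed loop -/

/-- At a local optimum with `h > 0` the controller vanishes. -/
theorem sgfControl_eq_zero_of_isLocalOptimum (hreg : RelativeDegreeRegularity f w h b Φ β r)
    (hopt : (feedbackProblem w h b Φ).IsLocalOptimum (xs, us) ()) (hpos : 0 < h xs)
    (hε : 0 < ε) (hα : 0 < α) : sgfControl w b Φ ε α (xs, us) = 0 := by
  have hmin := eventually_le_of_isLocalOptimum hreg.w_smooth.continuous
    hreg.h_smooth.continuous hopt hpos
  obtain ⟨h1, -, hb⟩ := feedbackProblem_feasible_iff.1 hopt.1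
  obtain rfl : xs = w us := h1
  obtain ⟨lam, hlam, hgrad, hcomp⟩ := exists_multiplier_of_reduced_local_min hreg hpos hb hmin
  rw [sgfControl, hgrad]
  refine halfspaceProj_eq_zero hε (by linarith [mul_nonneg hα.le hb]) hlam ?_
  linear_combination -α * hcomp

/-- Near the optimum the constraint on `h_r` is inactive at the value of the controller, because
`h_r = β ^ r h > 0` there, while `f` and the controller are small. -/
theorem eventually_slack (hreg : RelativeDegreeRegularity f w h b Φ β r) (hβ : 0 < β)
    (hf : f (xs, us) = 0) (hpos : 0 < h xs) (hγ : 0 < γ)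
    {k : Euc n × Euc m → Euc m} (hk : ContinuousAt k (xs, us)) (hk0 : k (xs, us) = 0) :
    ∀ᶠ z in 𝓝 (xs, us), 0 < dhcbfState f h β r z (f z) + dhcbfInput f h β r z (k z)
      + γ * hcbf f h β r z := by
  have hcont : ContinuousAt (fun z => dhcbfState f h β r z (f z) + dhcbfInput f h β r z (k z)
      + γ * hcbf f h β r z) (xs, us) :=
    ((hreg.continuous_dhcbfState.clm_apply hreg.f_smooth.continuous).continuousAt.add
      (hreg.continuous_dhcbfInput.continuousAt.clm_apply hk)).add
      (continuousAt_const.mul hreg.contDiff_hcbf_two.continuous.continuousAt)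
  refine hcont.eventually_const_lt ?_
  simp only [hf, hk0, map_zero]
  rw [hcbf_eq_of_equilibrium hf]
  have := pow_pos hβ r
  positivity

/-- The set `b ≥ 0` is invariant under the controller: `b` decays at most at the rate `α`. -/
theorem nonneg_of_closedLoop (hb : Differentiable ℝ b) {ζ : ℝ → Euc n × Euc m} {T : ℝ}
    (hT : 0 ≤ T) (h0 : 0 ≤ b (ζ 0).2)
    (hζ : ∀ t ∈ Icc 0 T, ∃ v, HasDerivWithinAt ζ v (Ici 0) t ∧
      -(α * b (ζ t).2) ≤ fderiv ℝ b (ζ t).2 v.2) : 0 ≤ b (ζ T).2 := by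
  have hmono := le_sub_mul_of_hasDerivWithinAt_le
    (g := fun t => -(Real.exp (α * t) * b (ζ t).2)) (d := 0) hT fun t ht => by
      obtain ⟨v, hv, hle⟩ := hζ t ht
      have h1 : HasDerivWithinAt (fun t => b (ζ t).2) (fderiv ℝ b (ζ t).2 v.2) (Ici 0) t :=
        (hb _).hasFDerivAt.comp_hasDerivWithinAt t
          ((hasFDerivAt_snd (𝕜 := ℝ) (p := ζ t)).comp_hasDerivWithinAt t hv)
      have h2 : HasDerivWithinAt (fun t => Real.exp (α * t)) (Real.exp (α * t) * α) (Ici 0) t := by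
        simpa using ((hasDerivAt_id t).const_mul α).exp.hasDerivWithinAt
      refine ⟨_, (h2.fun_mul h1).fun_neg, ?_⟩
      nlinarith [mul_le_mul_of_nonneg_left hle (Real.exp_pos (α * t)).le]
  simp only [mul_zero, Real.exp_zero, one_mul, zero_mul, sub_zero, neg_le_neg_iff] at hmono
  exact nonneg_of_mul_nonneg_right (h0.trans hmono) (Real.exp_pos (α * T))

end ClosedLoop

theorem theorem1 {n m : ℕ}
    (f : Euc n × Euc m → Euc n) (w : Euc m → Euc n)
    (h : Euc n → ℝ) (b : Euc m → ℝ) (Φ : Euc n → ℝ)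
    (β : ℝ) (hβ : 0 < β) (r : ℕ)
    (hstab : IsSteadyStateMap f w)
    (hreg : RelativeDegreeRegularity f w h b Φ β r)
    (xs : Euc n) (us : Euc m)
    (hopt : (feedbackProblem w h b Φ).IsLocalOptimum (xs, us) ())
    (hpos : 0 < h xs)
    (N : Set (Euc n × Euc m)) (hN : N ∈ 𝓝 (xs, us))
    (hcrit : ∀ z ∈ N, (feedbackProblem w h b Φ).IsCritical z () → z = (xs, us))
    (hlevel : ∀ c : ℝ, IsCompact {u : Euc m | Φ (w u) = c})
    (hCQ : ∀ z ∈ N, z ∈ (feedbackProblem w h b Φ).feasible () →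
      (feedbackProblem w h b Φ).MFCQ z () ∨ (feedbackProblem w h b Φ).CRCQ z ()) :
    ∃ εs > 0, ∃ γs > 0, ∀ ε γ α : ℝ, 0 < ε → ε < εs → γs ≤ γ → 0 < α →
      -- the quadratic program is feasible everywhere in `N`
      (∀ z ∈ N, ((sgfQP f w h b Φ β r ε α γ).feasible z).Nonempty) →
      -- it satisfies a constraint qualification at its solution, everywhere in `N`
      (∀ z ∈ N, ∀ q, (sgfQP f w h b Φ β r ε α γ).IsSolution q z →
        (sgfQP f w h b Φ β r ε α γ).MFCQ q z ∨ (sgfQP f w h b Φ β r ε α γ).CRCQ q z) →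
      -- the closed loop has a unique solution from each point of `N`
      (∀ z ∈ N, HasUniqueClosedLoopSolution f (sgfQP f w h b Φ β r ε α γ) z) →
      IsLocallyAsymptoticallyStableRel
        (IsClosedLoopSolutionOn f (sgfQP f w h b Φ β r ε α γ) (Ici 0))
        (safeSet f h b β r) (xs, us) := by
  have hxs : xs = w us := (feedbackProblem_feasible_iff.1 hopt.1).1
  subst hxs
  have hbus : 0 ≤ b us := (feedbackProblem_feasible_iff.1 hopt.1).2.2
  have hfeq : f (w us, us) = 0 := (hstab us).1.1
  have hwc : Continuous w := hreg.w_smooth.continuous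
  have hwd : Differentiable ℝ w := hreg.w_smooth.differentiable two_ne_zero
  have hΦd : Differentiable ℝ Φ := hreg.Φ_smooth.differentiable two_ne_zero
  have hbd : Differentiable ℝ b := hreg.b_smooth.differentiable two_ne_zero
  obtain ⟨P, C, hC, hPsymm, hPpos, hbound⟩ := exists_compositeLyapunov_bound hstab hreg us
  -- For `ε < 1 / (C² + 1)` the cross term `C ‖y‖ ‖q‖` is at most `‖y‖² / 4 + (1 / ε - 1) ‖q‖²`.
  refine ⟨1 / (C ^ 2 + 1), by positivity, 1, one_pos, fun ε γ α hε hεs hγ hα _ _ _ => ?_⟩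
  set Q := sgfQP f w h b Φ β r ε α γ
  set k := sgfControl w b Φ ε α
  have hk0 : k (w us, us) = 0 := sgfControl_eq_zero_of_isLocalOptimum hreg hopt hpos hε hα
  obtain ⟨K₁, s₁, hs₁, hK₁⟩ := exists_lipschitzOnWith_sgfControl (ε := ε) hreg hα hbus hpos.le
  obtain ⟨K₂, s₂, hs₂, hK₂⟩ := (hreg.f_smooth.of_le
    (by exact_mod_cast Nat.succ_pos r : (1 : WithTop ℕ∞) ≤ _)).locallyLipschitz (w us, us)
  have hNev : ∀ᶠ z : Euc n × Euc m in 𝓝 (w us, us), (w z.2, z.2) ∈ N := by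
    have : Continuous fun z : Euc n × Euc m => (w z.2, z.2) := by fun_prop
    exact this.tendsto (w us, us) hN
  have hstrict : ∀ᶠ z : Euc n × Euc m in 𝓝 (w us, us),
      0 ≤ b z.2 → z.2 ≠ us → Φ (w us) < Φ (w z.2) :=
    continuous_snd.tendsto (w us, us) (eventually_lt_of_isLocalOptimum hreg hopt hpos hN hcrit)
  have hhpos : ∀ᶠ z : Euc n × Euc m in 𝓝 (w us, us), 0 < h (w z.2) :=
    ((hreg.h_smooth.continuous.comp hwc).comp continuous_snd).continuousAt.eventually_const_lt hpos
  have hrpos : ∀ᶠ z : Euc n × Euc m in 𝓝 (w us, us), 0 < hcbf f h β r z := by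
    refine hreg.contDiff_hcbf_two.continuous.continuousAt.eventually_const_lt ?_
    rw [hcbf_eq_of_equilibrium hfeq]
    exact mul_pos (pow_pos hβ r) hpos
  have hsol : ∀ᶠ z in 𝓝 (w us, us), ∀ q, Q.IsSolution q z ↔ q = k z := by
    filter_upwards [eventually_gradient_ne_zero_or hreg hα hbus hpos.le,
      eventually_slack hreg hβ hfeq hpos (by linarith : 0 < γ)
        (hK₁.continuousOn.continuousAt hs₁) hk0] with z hz1 hz2 q
    exact sgfQP_isSolution_iff hz1 hz2.le
  obtain ⟨R, hR, hball⟩ := Metric.nhds_basis_closedBall.mem_iff.1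
    (inter_mem (inter_mem hs₁ hs₂) ((hNev.and hbound).and ((hstrict.and hhpos).and
      (hrpos.and (hsol.and (eventually_gradient_ne_zero_or hreg hα hbus hpos.le))))))
  set B := Metric.closedBall (w us, us) R with hB
  replace hNev := fun z (hz : z ∈ B) => (hball hz).2.1.1
  replace hbound := fun z (hz : z ∈ B) => (hball hz).2.1.2
  replace hstrict := fun z (hz : z ∈ B) => (hball hz).2.2.1.1
  replace hhpos := fun z (hz : z ∈ B) => (hball hz).2.2.1.2
  replace hrpos := fun z (hz : z ∈ B) => (hball hz).2.2.2.1
  replace hsol := fun z (hz : z ∈ B) => (hball hz).2.2.2.2.1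
  have hreg1 := fun z (hz : z ∈ B) => (hball hz).2.2.2.2.2
  have hkc : ContinuousOn k B := (hK₁.mono fun z hz => (hball hz).1.1).continuousOn
  -- The closed-loop vector field, and a bounded Lipschitz extension of it.
  have hFlip : LipschitzOnWith (max K₂ K₁) (fun z => (f z, k z)) B :=
    (hK₂.mono fun z hz => (hball hz).1.2).prodMk (hK₁.mono fun z hz => (hball hz).1.1)
  obtain ⟨M, hM⟩ := (isCompact_closedBall (w us, us) R).exists_bound_of_continuousOn
    hFlip.continuousOn
  obtain ⟨F, K, L, hFK, hFL, hFeq⟩ := hFlip.exists_bounded_extension hM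
  -- The Lyapunov function `U` and its rate of decrease `D`.
  set U := fun z => compositeLyapunov w Φ P z - Φ (w us) with hU
  set D := fun z => ‖k z‖ ^ 2 + 1 / 4 * ‖z.1 - w z.2‖ ^ 2 with hD
  have hUc : Continuous U := by
    have h1 : Continuous fun z : Euc n × Euc m => z.1 - w z.2 := by fun_prop
    exact ((hΦd.continuous.comp (hwc.comp continuous_snd)).add
      ((P.continuous.comp h1).inner h1)).sub continuous_const
  have hDc : ContinuousOn D B := by
    have h1 : Continuous fun z : Euc n × Euc m => 1 / 4 * ‖z.1 - w z.2‖ ^ 2 := by fun_prop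
    exact (hkc.norm.pow 2).add h1.continuousOn
  have hPnonneg : ∀ x, 0 ≤ inner ℝ (P x) x := by
    intro x
    by_cases hx : x = 0
    · simp [hx]
    · exact (hPpos x hx).le
  have hUpos : ∀ z ∈ B ∩ {z | 0 ≤ b z.2}, z ≠ (w us, us) → 0 < U z ∧ 0 < D z := by
    rintro z ⟨hz, hbz⟩ hne
    constructor
    · by_cases hu : z.2 = us
      · have hx : z.1 - w z.2 ≠ 0 := fun h0 =>
          hne (Prod.ext ((sub_eq_zero.1 h0).trans (by rw [hu])) hu)
        have := hPpos _ hx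
        simp only [hU, compositeLyapunov, hu] at this ⊢
        linarith
      · have := hstrict z hz hbz hu
        simp only [hU, compositeLyapunov]
        linarith [hPnonneg (z.1 - w z.2)]
    · -- If `D` vanished, then `(x, u)` would be a critical point.
      have hD0 : 0 ≤ D z := by positivity
      refine lt_of_le_of_ne hD0 fun h0 => hne ?_
      have h1 := sq_nonneg ‖k z‖
      have h2 := sq_nonneg ‖z.1 - w z.2‖
      have hk : k z = 0 := by
        rw [← norm_eq_zero, ← pow_eq_zero_iff two_ne_zero]
        simp only [hD] at h0
        linarith
      have hx : z.1 = w z.2 := by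
        rw [← sub_eq_zero, ← norm_eq_zero, ← pow_eq_zero_iff two_ne_zero]
        simp only [hD] at h0
        linarith
      have hzeq : z = (w z.2, z.2) := Prod.ext hx rfl
      obtain ⟨lam, hlam, hgrad, hcomp⟩ := exists_multiplier_of_halfspaceProj_eq_zero hε hk
      rw [hzeq] at hgrad hcomp ⊢
      refine hcrit _ (hNev z hz)
        (isCritical_of_multiplier hreg (hhpos z hz).le hbz hlam hgrad ?_)
      have : α * (lam * b z.2) = 0 := by linear_combination -hcomp
      exact (mul_eq_zero.1 this).resolve_left hα.ne'
  have hrate : ∀ z ∈ B, 0 ≤ b z.2 →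
      fderiv ℝ Φ (w z.2) (fderiv ℝ w z.2 (k z)) +
        2 * inner ℝ (P (z.1 - w z.2)) (f z - fderiv ℝ w z.2 (k z)) ≤ -D z := by
    intro z hz hbz
    have h1 := hbound z hz (k z)
    have h2 : ‖k z‖ ^ 2 ≤ -(ε * inner ℝ (inputGradient w Φ z) (k z)) :=
      norm_sgfControl_sq_le hα hbz
    have h3 : C ^ 2 + 1 < 1 / ε := by
      rw [lt_div_iff₀ hε, mul_comm]
      exact (lt_div_iff₀ (by positivity)).1 hεs
    have h4 : (C ^ 2 + 1) * ‖k z‖ ^ 2 ≤ -inner ℝ (inputGradient w Φ z) (k z) := by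
      refine (mul_le_mul_of_nonneg_right h3.le (sq_nonneg _)).trans ?_
      rw [one_div, inv_mul_le_iff₀ hε]
      linarith
    have h5 := sq_nonneg (C * ‖k z‖ - 1 / 2 * ‖z.1 - w z.2‖)
    simp only [hD]
    nlinarith
  intro N₂ hN₂
  obtain ⟨ρ, hρ, hρN⟩ := Metric.mem_nhds_iff.1 hN₂
  obtain ⟨δ, hδ, hstable⟩ := lyapunov_stable_rel hR
    (isClosed_le continuous_const (hbd.continuous.comp continuous_snd) :
      IsClosed {z : Euc n × Euc m | 0 ≤ b z.2})
    hUc.continuousOn hDc (by simp [hU, compositeLyapunov]) hUpos (by positivity)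
    (lt_min hρ hR)
  -- Every curve that follows the closed-loop vector field while it is in the ball is trapped.
  have htrap : ∀ ζ : ℝ → Euc n × Euc m, ContinuousOn ζ (Ici 0) →
      ζ 0 ∈ Metric.ball (w us, us) δ → 0 ≤ b (ζ 0).2 →
      (∀ t, 0 ≤ t → ζ t ∈ B → HasDerivWithinAt ζ (f (ζ t), k (ζ t)) (Ici 0) t) →
      (∀ t, 0 ≤ t → ζ t ∈ Metric.ball (w us, us) (min ρ R) ∩ {z | 0 ≤ b z.2}) ∧
        Tendsto ζ atTop (𝓝 (w us, us)) := by
    intro ζ hζc hζ0 hb0 hζ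
    refine hstable ζ hζc hζ0 fun T hT hin t ht => ?_
    have hbt : 0 ≤ b (ζ t).2 := nonneg_of_closedLoop hbd ht.1 hb0 fun s hs =>
      have hsB := hin s ⟨hs.1, hs.2.trans ht.2⟩
      ⟨_, hζ s hs.1 hsB, neg_le_inner_sgfControl (hreg1 _ hsB)⟩
    exact ⟨hbt, _, (hasDerivWithinAt_compositeLyapunov hwd hΦd hPsymm
      (hζ t ht.1 (hin t ht))).sub_const _, hrate _ (hin t ht) hbt⟩
  refine ⟨Metric.ball (w us, us) δ, Metric.ball_mem_nhds _ hδ, fun z₀ hz₀ => ⟨?_, ?_⟩⟩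
  · obtain ⟨ζ, hζ0, hζ⟩ := exists_forward_solution_of_lipschitz_of_bounded hFK hFL z₀
    have hζB : ∀ t, 0 ≤ t → ζ t ∈ B → HasDerivWithinAt ζ (f (ζ t), k (ζ t)) (Ici 0) t := by
      intro t ht hB
      have := hζ t ht
      rwa [← hFeq hB] at this
    obtain ⟨h1, -⟩ := htrap ζ (fun t ht => (hζ t ht).continuousWithinAt) (by rw [hζ0]; exact hz₀.1)
      (by rw [hζ0]; exact hz₀.2.1) hζB
    refine ⟨ζ, fun t ht => ?_, hζ0⟩
    have hB := Metric.ball_subset_closedBall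
      (Metric.ball_subset_ball (min_le_right ρ R) (h1 t ht).1)
    exact ⟨k (ζ t), (hsol _ hB _).2 rfl, hζB t ht hB⟩
  · intro ζ hζ hζ0
    have hζc : ContinuousOn ζ (Ici 0) := fun t ht => by
      obtain ⟨q, -, hq⟩ := hζ t ht
      exact hq.continuousWithinAt
    obtain ⟨h1, h2⟩ := htrap ζ hζc (by rw [hζ0]; exact hz₀.1) (by rw [hζ0]; exact hz₀.2.1)
      fun t ht hB => by
        obtain ⟨q, hq, hd⟩ := hζ t ht
        rwa [(hsol _ hB _).1 hq] at hd
    refine ⟨fun t ht => ⟨hρN (Metric.ball_subset_ball (min_le_left ρ R) (h1 t ht).1),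
      (h1 t ht).2, (hrpos _ ?_).le⟩, h2⟩
    exact Metric.ball_subset_closedBall (Metric.ball_subset_ball (min_le_right ρ R) (h1 t ht).1)
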